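/- Let $m\ge 2$, let $G=\langle g\rangle$ be a cyclic group of order $m$, let $k$ be a field of characteristic different from $2$ containing a primitive root of unity $\mathfrak q$ of order $m^2$, and put $q=\mathfrak q^m$. For $j\ge 0$ let $1_j=\frac1m\sum_{s=0}^{m-1}q^{-js}g^s\in k[G]$ (so $1_m=1_0$). For $0\le c\le m-1$ let $k_{\Phi_c}[G]$ be the group Hopf algebra $k[G]$ regarded as a quasi-Hopf algebra with reassociator $$\Phi_c=\sum_{i,j,l=0}^{m-1}q^{\,c\,i\lfloor (j+l)/m\rfloor}\,1_i\otimes 1_j\otimes 1_l .$$ A Hopf algebra in the braided category ${}^{k_{\Phi_c}[G]}_{k_{\Phi_c}[G]}\mathcal{YD}$ of left Yetter-Drinfeld modules is called a non-trivial $2$-dimensional one if it has dimension $2$ over $k$ and is not isomorphic to the group Hopf algebra $k[C_2]$ with trivial action and coaction. For a quasi-Hopf algebra $H$ with reassociator $\Phi=X^1\otimes X^2\otimes X^3$, $\Phi^{-1}=x^1\otimes x^2\otimes x^3=y^1\otimes y^2\otimes y^3$, an algebra map $\sigma:H\to k$ and $v\in H$ with $\sigma(v)=-1$, $\varepsilon(v)=1$,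 $\Delta(v)=\sigma(y^1x^3X^2)\,x^1X^1vy^2\otimes x^2vX^3y^3$ and $\sigma(h_2)h_1v=\sigma(h_1)vh_2$ for all $h\in H$, let $B_{\sigma,v}$ have basis $\{1,n\}$, unit $1$, $n^2=0$, action $h\cdot 1=\varepsilon(h)1$, $h\cdot n=\sigma(h)n$, coaction $1\mapsto 1\otimes 1$, $n\mapsto v\otimes n$, comultiplication $\Delta(1)=1\otimes 1$, $\Delta(n)=n\otimes 1+1\otimes n$, counit $\varepsilon(1)=1$, $\varepsilon(n)=0$, and antipode $S(1)=1$, $S(n)=-n$. Then: 1. If a non-trivial $2$-dimensional Hopf algebra $B$ exists in ${}^{k_{\Phi_c}[G]}_{k_{\Phi_c}[G]}\mathcal{YD}$, then $\gcd(c,m)$ is even, and $B$ is isomorphic to $B_{\sigma,v}$ for a pair $(\sigma,v)$ given by $$\sigma(g^j)=q^{fj}\ \ (j\ge 0),\qquad v=\sum_{j=1}^{m}\mathfrak q^{\,m\lambda j+cfj}\,1_j ,$$ where $f,\lambda\in\{0,\dots,m-1\}$ satisfy $$\frac{\lambda f}{m}+\frac{cf^2}{m^2}-\frac12\in\mathbb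 Z .\qquad(*)$$ 2. Conversely, for all $f,\lambda\in\{0,\dots,m-1\}$ satisfying $(*)$, the pair $(\sigma,v)$ above satisfies the conditions required for $B_{\sigma,v}$ to be defined, and $B_{\sigma,v}$ is a non-trivial $2$-dimensional Hopf algebra in ${}^{k_{\Phi_c}[G]}_{k_{\Phi_c}[G]}\mathcal{YD}$. 3. If $\gcd(c,m)$ is even, there are $f,\lambda\in\{0,\dots,m-1\}$ satisfying $(*)$; in particular a non-trivial $2$-dimensional Hopf algebra exists in ${}^{k_{\Phi_c}[G]}_{k_{\Phi_c}[G]}\mathcal{YD}$. -/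

import Mathlib

open scoped TensorProduct

noncomputable section

namespace YD

open LinearMap (mulLeft mulRight mul')

/-- A quasi-bialgebra `(H, Δ, ε, Φ)` over the field `k` in the sense of Drinfeld.
The reassociator `Φ` lives in `H ⊗ (H ⊗ H)`. -/
structure QuasiBialgebra (k H : Type*) [Field k] [Ring H] [Algebra k H] where
  comul : H →ₐ[k] H ⊗[k] H
  counit : H →ₐ[k] k
  Phi : (H ⊗[k] (H ⊗[k] H))ˣ
  /-- `(id ⊗ Δ)(Δ h) = Φ (Δ ⊗ id)(Δ h) Φ⁻¹` -/
  quasi_coassoc : ∀ h : H,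
    Algebra.TensorProduct.map (AlgHom.id k H) comul (comul h) =
      (Phi : H ⊗[k] (H ⊗[k] H)) *
        Algebra.TensorProduct.assoc k k k H H H
          (Algebra.TensorProduct.map comul (AlgHom.id k H) (comul h)) *
        (↑Phi⁻¹ : H ⊗[k] (H ⊗[k] H))
  /-- `(id ⊗ ε)(Δ h) = h` -/
  id_counit_comul : ∀ h : H, Algebra.TensorProduct.rid k k H
    (Algebra.TensorProduct.map (AlgHom.id k H) counit (comul h)) = h
  /-- `(ε ⊗ id)(Δ h) = h` -/
  counit_id_comul : ∀ h : H, Algebra.TensorProduct.lid k H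
    (Algebra.TensorProduct.map counit (AlgHom.id k H) (comul h)) = h
  /-- `(1 ⊗ Φ) (id ⊗ Δ ⊗ id)(Φ) (Φ ⊗ 1) = (id ⊗ id ⊗ Δ)(Φ) (Δ ⊗ id ⊗ id)(Φ)` -/
  pentagon :
    ((1 : H) ⊗ₜ[k] (Phi : H ⊗[k] (H ⊗[k] H))) *
      Algebra.TensorProduct.map (AlgHom.id k H)
        ((Algebra.TensorProduct.assoc k k k H H H).toAlgHom.comp
          (Algebra.TensorProduct.map comul (AlgHom.id k H))) (Phi : H ⊗[k] (H ⊗[k] H)) *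
      Algebra.TensorProduct.map (AlgHom.id k H)
        (Algebra.TensorProduct.map (AlgHom.id k H)
          (Algebra.TensorProduct.includeLeft : H →ₐ[k] H ⊗[k] H)) (Phi : H ⊗[k] (H ⊗[k] H)) =
    Algebra.TensorProduct.map (AlgHom.id k H)
        (Algebra.TensorProduct.map (AlgHom.id k H) comul) (Phi : H ⊗[k] (H ⊗[k] H)) *
      Algebra.TensorProduct.assoc k k k H H (H ⊗[k] H)
        (Algebra.TensorProduct.map comul (AlgHom.id k (H ⊗[k] H)) (Phi : H ⊗[k] (H ⊗[k] H)))
  /-- `(id ⊗ ε ⊗ id)(Φ) = 1 ⊗ 1` -/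
  normalized :
    Algebra.TensorProduct.map (AlgHom.id k H)
      ((Algebra.TensorProduct.lid k H).toAlgHom.comp
        (Algebra.TensorProduct.map counit (AlgHom.id k H))) (Phi : H ⊗[k] (H ⊗[k] H)) = 1

/-- A quasi-Hopf algebra: a quasi-bialgebra with an algebra anti-morphism `S` and
elements `α`, `β`. -/
structure QuasiHopfAlgebra (k H : Type*) [Field k] [Ring H] [Algebra k H] extends
    QuasiBialgebra k H where
  S : H →ₗ[k] H
  alpha : H
  beta : H
  S_one : S 1 = 1
  S_mul : ∀ a b : H, S (a * b) = S b * S a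
  /-- `S(h₁) α h₂ = ε(h) α` -/
  antipode_alpha : ∀ h : H,
    mul' k H (TensorProduct.map (mulRight k alpha ∘ₗ S) LinearMap.id (comul h)) =
      counit h • alpha
  /-- `h₁ β S(h₂) = ε(h) β` -/
  antipode_beta : ∀ h : H,
    mul' k H (TensorProduct.map (mulRight k beta) S (comul h)) = counit h • beta
  /-- `X¹ β S(X²) α X³ = 1` -/
  beta_S_alpha :
    mul' k H (TensorProduct.map (mulRight k beta)
      (mul' k H ∘ₗ TensorProduct.map (mulRight k alpha ∘ₗ S) LinearMap.id)
      (Phi : H ⊗[k] (H ⊗[k] H))) = 1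
  /-- `S(x¹) α x² β S(x³) = 1` -/
  S_alpha_beta :
    mul' k H (TensorProduct.map (mulRight k alpha ∘ₗ S)
      (mul' k H ∘ₗ TensorProduct.map (mulRight k beta) S)
      (↑Phi⁻¹ : H ⊗[k] (H ⊗[k] H))) = 1

section Modules

variable {k H : Type*} [Field k] [Ring H] [Algebra k H]

/-- If `H` acts on `M` and `K` acts on `N`, then `H ⊗ K` acts on `M ⊗ N` componentwise. -/
def tensorAct {K M N : Type*} [Ring K] [Algebra k K] [AddCommGroup M] [Module k M]
    [AddCommGroup N] [Module k N]
    (r : H →ₐ[k] Module.End k M) (s : K →ₐ[k] Module.End k N) :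
    H ⊗[k] K →ₐ[k] Module.End k (M ⊗[k] N) :=
  Module.endTensorEndAlgHom.comp (Algebra.TensorProduct.map r s)

/-- For `d : M → K ⊗ M`, `d(m) = m_{[-1]} ⊗ m_{[0]}`, the map
`x ⊗ y ↦ (m ↦ (x · m)_{[-1]} y ⊗ (x · m)_{[0]})`. -/
def actThenMul {K M : Type*} [Ring K] [Algebra k K] [AddCommGroup M] [Module k M]
    (r : H →ₐ[k] Module.End k M) (d : M →ₗ[k] K ⊗[k] M) :
    H ⊗[k] K →ₗ[k] (M →ₗ[k] K ⊗[k] M) :=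
  TensorProduct.lift <| LinearMap.mk₂ k
    (fun x y => (mulRight k y).rTensor M ∘ₗ d ∘ₗ r x)
    (by intros; ext; simp) (by intros; ext; simp)
    (by
      intro x y z; ext m
      have h : mulRight k (y + z) = mulRight k y + mulRight k z := by ext a; simp [mul_add]
      simp [h, LinearMap.rTensor_add])
    (by
      intro a x y; ext m
      have h : mulRight k (a • y) = a • mulRight k y := by ext a; simp
      simp [h, LinearMap.rTensor_smul])

namespace QuasiBialgebra

variable (Q : QuasiBialgebra k H)

/-- The pair (`act`, `coact`) makes `M` a left Yetter-Drinfeld module over `H`. Left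
`H`-modules are given by algebra maps `H → End M`. -/
structure IsYDModule {M : Type*} [AddCommGroup M] [Module k M]
    (act : H →ₐ[k] Module.End k M) (coact : M →ₗ[k] H ⊗[k] M) : Prop where
  /-- `ε(m_{[-1]}) m_{[0]} = m` -/
  counit_coact : ∀ m : M,
    TensorProduct.lid k M (Q.counit.toLinearMap.rTensor M (coact m)) = m
  /-- `X¹ m_{[-1]} ⊗ (X² · m_{[0]})_{[-1]} X³ ⊗ (X² · m_{[0]})_{[0]}`
  `= X¹ (Y¹ · m)_{[-1]₁} Y² ⊗ X² (Y¹ · m)_{[-1]₂} Y³ ⊗ X³ · (Y¹ · m)_{[0]}` -/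
  coact_coassoc : ∀ m : M,
    TensorProduct.homTensorHomMap (RingHom.id k) H M H (H ⊗[k] M)
        (TensorProduct.map (LinearMap.mul k H) (actThenMul act coact)
          (Q.Phi : H ⊗[k] (H ⊗[k] H))) (coact m) =
      tensorAct (Algebra.lmul k H) (tensorAct (Algebra.lmul k H) act)
        (Q.Phi : H ⊗[k] (H ⊗[k] H))
        (TensorProduct.assoc k H H M
          (actThenMul act (Q.comul.toLinearMap.rTensor M ∘ₗ coact)
            (Q.Phi : H ⊗[k] (H ⊗[k] H)) m))
  /-- `h₁ m_{[-1]} ⊗ h₂ · m_{[0]} = (h₁ · m)_{[-1]} h₂ ⊗ (h₁ · m)_{[0]}` -/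
  act_coact : ∀ (h : H) (m : M),
    tensorAct (Algebra.lmul k H) act (Q.comul h) (coact m) =
      actThenMul act coact (Q.comul h) m

section Tensor

variable {M N P : Type*} [AddCommGroup M] [Module k M] [AddCommGroup N] [Module k N]
  [AddCommGroup P] [Module k P]

/-- The diagonal action `h · (m ⊗ n) = h₁ · m ⊗ h₂ · n`. -/
def diagAct (actM : H →ₐ[k] Module.End k M) (actN : H →ₐ[k] Module.End k N) :
    H →ₐ[k] Module.End k (M ⊗[k] N) :=
  (tensorAct actM actN).comp Q.comul

/-- The coaction on `M ⊗ N`: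
`m ⊗ n ↦ X¹ (x¹ Y¹ · m)_{[-1]} x² (Y² · n)_{[-1]} Y³ ⊗ X² · (x¹ Y¹ · m)_{[0]}`
`⊗ X³ x³ · (Y² · n)_{[0]}`. -/
def diagCoact (actM : H →ₐ[k] Module.End k M) (coactM : M →ₗ[k] H ⊗[k] M)
    (actN : H →ₐ[k] Module.End k N) (coactN : N →ₗ[k] H ⊗[k] N) :
    M ⊗[k] N →ₗ[k] H ⊗[k] (M ⊗[k] N) :=
  (tensorAct (Algebra.lmul k H) (tensorAct actM actN) (Q.Phi : H ⊗[k] (H ⊗[k] H)))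
    ∘ₗ (mul' k H).rTensor (M ⊗[k] N)
    ∘ₗ (TensorProduct.tensorTensorTensorComm k H M H N).toLinearMap
    ∘ₗ coactM.rTensor (H ⊗[k] N)
    ∘ₗ (tensorAct actM (tensorAct (Algebra.lmul k H) actN)
        (↑Q.Phi⁻¹ : H ⊗[k] (H ⊗[k] H)))
    ∘ₗ TensorProduct.homTensorHomMap (RingHom.id k) M N M (H ⊗[k] N)
        (TensorProduct.map actM.toLinearMap (actThenMul actN coactN)
          (Q.Phi : H ⊗[k] (H ⊗[k] H)))

/-- The associativity constraint `(m ⊗ n) ⊗ p ↦ X¹ · m ⊗ (X² · n ⊗ X³ · p)`. -/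
def associator (actM : H →ₐ[k] Module.End k M) (actN : H →ₐ[k] Module.End k N)
    (actP : H →ₐ[k] Module.End k P) :
    (M ⊗[k] N) ⊗[k] P →ₗ[k] M ⊗[k] (N ⊗[k] P) :=
  (tensorAct actM (tensorAct actN actP) (Q.Phi : H ⊗[k] (H ⊗[k] H)))
    ∘ₗ (TensorProduct.assoc k M N P).toLinearMap

/-- The inverse constraint `m ⊗ (n ⊗ p) ↦ (x¹ · m ⊗ x² · n) ⊗ x³ · p`. -/
def associatorInv (actM : H →ₐ[k] Module.End k M) (actN : H →ₐ[k] Module.End k N)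
    (actP : H →ₐ[k] Module.End k P) :
    M ⊗[k] (N ⊗[k] P) →ₗ[k] (M ⊗[k] N) ⊗[k] P :=
  (TensorProduct.assoc k M N P).symm.toLinearMap
    ∘ₗ (tensorAct actM (tensorAct actN actP) (↑Q.Phi⁻¹ : H ⊗[k] (H ⊗[k] H)))

end Tensor

end QuasiBialgebra

/-- The braiding `m ⊗ n ↦ m_{[-1]} · n ⊗ m_{[0]}`. -/
def braiding {M N : Type*} [AddCommGroup M] [Module k M] [AddCommGroup N] [Module k N]
    (coactM : M →ₗ[k] H ⊗[k] M) (actN : H →ₐ[k] Module.End k N) :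
    M ⊗[k] N →ₗ[k] N ⊗[k] M :=
  (TensorProduct.lift actN.toLinearMap).rTensor M
    ∘ₗ (TensorProduct.rightComm k H M N).toLinearMap
    ∘ₗ coactM.rTensor N

end Modules

/-- The operations of a braided Hopf algebra on the vector space `B`: an action and a coaction
of `H`, a multiplication with unit, a comultiplication with counit, an antipode.
The laws are in `IsBraidedHopfAlgebra`. -/
structure BraidedHopfData (k H B : Type*) [Field k] [Ring H] [Algebra k H]
    [AddCommGroup B] [Module k B] where
  act : H →ₐ[k] Module.End k B
  coact : B →ₗ[k] H ⊗[k] B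
  mul : B ⊗[k] B →ₗ[k] B
  one : B
  comul : B →ₗ[k] B ⊗[k] B
  counit : B →ₗ[k] k
  antipode : B →ₗ[k] B

section Braided

variable {k H B : Type*} [Field k] [Ring H] [Algebra k H] [AddCommGroup B] [Module k B]

/-- The multiplication of the tensor product algebra `B ⊗ B` in the category of Yetter-Drinfeld
modules: `(b ⊗ c)(b' ⊗ c')` is the image of `(b ⊗ c) ⊗ (b' ⊗ c')` under
`(B B)(B B) → B (B (B B)) → B ((B B) B) → B ((B B) B) → B (B (B B)) → (B B)(B B) → B B`,
where the third arrow braids `c` past `b'` and the last one multiplies, so it is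
`(y¹X¹ · b)(y²Y¹(x¹X² · c)_{[-1]} x²X³₁ · b') ⊗ (y³₁Y² · (x¹X² · c)_{[0]})(y³₂Y³x³X³₂ · c')`. -/
def tensorMul (Q : QuasiBialgebra k H) (D : BraidedHopfData k H B) :
    (B ⊗[k] B) ⊗[k] (B ⊗[k] B) →ₗ[k] B ⊗[k] B :=
  TensorProduct.map D.mul D.mul
    ∘ₗ Q.associatorInv D.act D.act (Q.diagAct D.act D.act)
    ∘ₗ (Q.associator D.act D.act D.act).lTensor B
    ∘ₗ ((braiding D.coact D.act).rTensor B).lTensor B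
    ∘ₗ (Q.associatorInv D.act D.act D.act).lTensor B
    ∘ₗ Q.associator D.act D.act (Q.diagAct D.act D.act)

/-- `D` is a Hopf algebra in the braided category of left Yetter-Drinfeld modules over `Q`. -/
structure IsBraidedHopfAlgebra (Q : QuasiBialgebra k H) (D : BraidedHopfData k H B) : Prop where
  isYDModule : Q.IsYDModule D.act D.coact
  -- a unital associative algebra whose structure maps are linear and colinear
  one_mul : ∀ b, D.mul (D.one ⊗ₜ b) = b
  mul_one : ∀ b, D.mul (b ⊗ₜ D.one) = b
  mul_assoc : D.mul ∘ₗ D.mul.rTensor B =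
    D.mul ∘ₗ D.mul.lTensor B ∘ₗ Q.associator D.act D.act D.act
  act_mul : ∀ h, D.act h ∘ₗ D.mul = D.mul ∘ₗ Q.diagAct D.act D.act h
  act_one : ∀ h, D.act h D.one = Q.counit h • D.one
  coact_mul : D.coact ∘ₗ D.mul =
    D.mul.lTensor H ∘ₗ Q.diagCoact D.act D.coact D.act D.coact
  coact_one : D.coact D.one = 1 ⊗ₜ D.one
  -- a counital coassociative coalgebra whose structure maps are linear and colinear
  counit_comul : ∀ b, TensorProduct.lid k B (D.counit.rTensor B (D.comul b)) = b
  comul_counit : ∀ b, TensorProduct.rid k B (D.counit.lTensor B (D.comul b)) = b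
  comul_coassoc : Q.associator D.act D.act D.act ∘ₗ D.comul.rTensor B ∘ₗ D.comul =
    D.comul.lTensor B ∘ₗ D.comul
  comul_act : ∀ h, D.comul ∘ₗ D.act h = Q.diagAct D.act D.act h ∘ₗ D.comul
  counit_act : ∀ h b, D.counit (D.act h b) = Q.counit h * D.counit b
  coact_comul : D.comul.lTensor H ∘ₗ D.coact =
    Q.diagCoact D.act D.coact D.act D.coact ∘ₗ D.comul
  coact_counit : ∀ b,
    TensorProduct.rid k H (D.counit.lTensor H (D.coact b)) = D.counit b • (1 : H)
  -- comultiplication and counit are algebra morphisms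
  comul_one : D.comul D.one = D.one ⊗ₜ D.one
  counit_one : D.counit D.one = 1
  counit_mul : ∀ b c, D.counit (D.mul (b ⊗ₜ c)) = D.counit b * D.counit c
  comul_mul : D.comul ∘ₗ D.mul = tensorMul Q D ∘ₗ TensorProduct.map D.comul D.comul
  -- the antipode
  antipode_act : ∀ h, D.antipode ∘ₗ D.act h = D.act h ∘ₗ D.antipode
  coact_antipode : D.coact ∘ₗ D.antipode = D.antipode.lTensor H ∘ₗ D.coact
  antipode_left : ∀ b, D.mul (D.antipode.rTensor B (D.comul b)) = D.counit b • D.one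
  antipode_right : ∀ b, D.mul (D.antipode.lTensor B (D.comul b)) = D.counit b • D.one

/-- Isomorphism of braided Hopf algebras: a linear, `H`-linear and `H`-colinear bijection that
respects multiplication, unit, comultiplication and counit (hence the antipode). -/
def BraidedHopfData.Isomorphic {B' : Type*} [AddCommGroup B'] [Module k B']
    (D : BraidedHopfData k H B) (D' : BraidedHopfData k H B') : Prop :=
  ∃ φ : B ≃ₗ[k] B',
    (∀ h b, φ (D.act h b) = D'.act h (φ b)) ∧
    (∀ b, D'.coact (φ b) = φ.toLinearMap.lTensor H (D.coact b)) ∧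
    (∀ b c, φ (D.mul (b ⊗ₜ c)) = D'.mul (φ b ⊗ₜ φ c)) ∧
    φ D.one = D'.one ∧
    (∀ b, D'.comul (φ b) = TensorProduct.map φ.toLinearMap φ.toLinearMap (D.comul b)) ∧
    (∀ b, D'.counit (φ b) = D.counit b)

/-- The group Hopf algebra `k[C₂]` with trivial action and coaction of `H`. -/
def trivialC2 (Q : QuasiBialgebra k H) :
    BraidedHopfData k H (MonoidAlgebra k (Multiplicative (ZMod 2))) where
  act := (Algebra.ofId k (Module.End k (MonoidAlgebra k (Multiplicative (ZMod 2))))).comp Q.counit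
  coact := TensorProduct.mk k H _ 1
  mul := mul' k _
  one := 1
  comul := Coalgebra.comul
  counit := Coalgebra.counit
  antipode := HopfAlgebra.antipode k

/-- `D` is a non-trivial `2`-dimensional braided Hopf algebra: it is not isomorphic to `k[C₂]`
with the trivial structure. -/
structure IsNontrivialTwoDim (Q : QuasiBialgebra k H) (D : BraidedHopfData k H B) : Prop where
  isHopf : IsBraidedHopfAlgebra Q D
  finrank_eq : Module.finrank k B = 2
  nontrivial : ¬ D.Isomorphic (trivialC2 Q)

/-- The conditions on a pair `(σ, v)` under which `B_{σ,v}` is defined: `σ(v) = -1`, `ε(v) = 1`,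
`Δ(v) = σ(y¹ x³ X²) x¹ X¹ v y² ⊗ x² v X³ y³` and `σ(h₂) h₁ v = σ(h₁) v h₂` for all `h`. -/
structure IsAdmissiblePair (Q : QuasiBialgebra k H) (σ : H →ₐ[k] k) (v : H) : Prop where
  sigma_v : σ v = -1
  counit_v : Q.counit v = 1
  comul_v : Q.comul v =
    TensorProduct.rid k _ (TensorProduct.map LinearMap.id σ.toLinearMap
        ((TensorProduct.assoc k H H H).symm (↑Q.Phi⁻¹ : H ⊗[k] (H ⊗[k] H)))) *
      ((1 ⊗ₜ v) *
        TensorProduct.map LinearMap.id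
          ((TensorProduct.lid k H).toLinearMap ∘ₗ σ.toLinearMap.rTensor H)
          (Q.Phi : H ⊗[k] (H ⊗[k] H)) *
        (v ⊗ₜ 1)) *
      TensorProduct.lid k _ (TensorProduct.map σ.toLinearMap LinearMap.id
        (↑Q.Phi⁻¹ : H ⊗[k] (H ⊗[k] H)))
  twist_v : ∀ h : H,
    TensorProduct.rid k H (σ.toLinearMap.lTensor H (Q.comul h)) * v =
      v * TensorProduct.lid k H (σ.toLinearMap.rTensor H (Q.comul h))

open TrivSqZeroExt in
/-- The braided Hopf algebra `B_{σ,v}` with basis `{1, n}`. Its algebra is generated by `n` with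
`n² = 0`, i.e. the dual numbers with `n = ε` (an element is `x = x.fst • 1 + x.snd • n`). Further
`h · 1 = ε(h) 1`, `h · n = σ(h) n`, the coaction is `1 ↦ 1 ⊗ 1`, `n ↦ v ⊗ n`,
`Δ(1) = 1 ⊗ 1`, `Δ(n) = n ⊗ 1 + 1 ⊗ n`, `ε(1) = 1`, `ε(n) = 0`, `S(1) = 1`, `S(n) = -n`. -/
def Bsv (Q : QuasiBialgebra k H) (σ : H →ₐ[k] k) (v : H) :
    BraidedHopfData k H (DualNumber k) where
  act :=
    { toFun := fun h =>
        { toFun := fun x => (Q.counit h * x.fst) • 1 + (σ h * x.snd) • DualNumber.eps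
          map_add' := by intro x y; ext <;> simp [mul_add]
          map_smul' := by intro a x; ext <;> simp [mul_left_comm] }
      map_one' := by ext <;> simp
      map_mul' := by intro a b; ext <;> simp [mul_assoc]
      map_zero' := by ext <;> simp
      map_add' := by intro a b; ext <;> simp [add_mul]
      commutes' := by intro a; ext <;> simp [Algebra.algebraMap_eq_smul_one] }
  coact :=
    { toFun := fun x => x.fst • (1 ⊗ₜ 1) + x.snd • (v ⊗ₜ DualNumber.eps)
      map_add' := by intro x y; simp only [fst_add, snd_add, add_smul]; abel
      map_smul' := by intro a x; simp [smul_smul] }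
  mul := mul' k (DualNumber k)
  one := 1
  comul :=
    { toFun := fun x => x.fst • (1 ⊗ₜ 1) +
        x.snd • (DualNumber.eps ⊗ₜ 1 + 1 ⊗ₜ DualNumber.eps)
      map_add' := by intro x y; simp only [fst_add, snd_add, add_smul]; abel
      map_smul' := by intro a x; simp [smul_smul] }
  counit :=
    { toFun := fun x => x.fst
      map_add' := by intro x y; simp
      map_smul' := by intro a x; simp }
  antipode :=
    { toFun := fun x => x.fst • 1 - x.snd • DualNumber.eps
      map_add' := by intro x y; ext <;> simp [add_comm]
      map_smul' := by intro a x; ext <;> simp }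

end Braided

section Cyclic

open Algebra.TensorProduct (productMap)

variable {k G : Type*} [Field k] [CommGroup G]

/-- `1_j = (1/m) ∑_{s=0}^{m-1} q^{-js} g^s` in `k[G]`. -/
def idem (m : ℕ) (q : k) (g : G) (j : ℕ) : MonoidAlgebra k G :=
  (m : k)⁻¹ • ∑ s ∈ Finset.range m, (q⁻¹) ^ (j * s) • MonoidAlgebra.of k G (g ^ s)

/-- `Φ_c = ∑_{i,j,l=0}^{m-1} q^{c i ⌊(j+l)/m⌋} 1_i ⊗ 1_j ⊗ 1_l`. -/
def reassociator (m : ℕ) (q : k) (g : G) (c : ℕ) :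
    MonoidAlgebra k G ⊗[k] (MonoidAlgebra k G ⊗[k] MonoidAlgebra k G) :=
  ∑ i ∈ Finset.range m, ∑ j ∈ Finset.range m, ∑ l ∈ Finset.range m,
    q ^ (c * i * ((j + l) / m)) • (idem m q g i ⊗ₜ (idem m q g j ⊗ₜ idem m q g l))

/-- The character of `k[G]` with `g ↦ q ^ a`. -/
def chi {m : ℕ} {q : k} {g : G} (hg : ∀ x, x ∈ Subgroup.zpowers g) (hG : Nat.card G = m)
    (hq : IsPrimitiveRoot q m) (hm : 2 ≤ m) (a : ℕ) : MonoidAlgebra k G →ₐ[k] k :=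
  MonoidAlgebra.lift k k G <| (Units.coeHom k).comp <|
    monoidHomOfForallMemZpowers hg
      (g' := (Units.mk0 q (hq.ne_zero (by omega))) ^ a) (by
        rw [orderOf_eq_card_of_forall_mem_zpowers hg, hG]
        apply orderOf_dvd_of_pow_eq_one
        ext
        have h : (q ^ a) ^ m = 1 := by rw [← pow_mul, mul_comm, pow_mul, hq.pow_eq_one, one_pow]
        simpa using h)

section Lemmas

variable {m : ℕ} {q : k} {g : G} (hg : ∀ x, x ∈ Subgroup.zpowers g) (hG : Nat.card G = m)
    (hq : IsPrimitiveRoot q m) (hm : 2 ≤ m)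

theorem chi_of (a s : ℕ) :
    chi hg hG hq hm a (MonoidAlgebra.of k G (g ^ s)) = q ^ (a * s) := by
  simp [chi, MonoidAlgebra.of_apply, MonoidAlgebra.lift_single, pow_mul]

theorem orth (hq : IsPrimitiveRoot q m) (hm : 2 ≤ m) (a b : ℕ) :
    (m : k)⁻¹ * ∑ s ∈ Finset.range m, (q⁻¹) ^ (b * s) * q ^ (a * s) =
      if a % m = b % m then 1 else 0 := by
  have h0 : q ≠ 0 := hq.ne_zero (by omega)
  have : NeZero m := ⟨by omega⟩
  have hm0 : (m : k) ≠ 0 := (hq.neZero').out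
  have e : ∀ s, (q⁻¹) ^ (b * s) * q ^ (a * s) = (q ^ a * (q⁻¹) ^ b) ^ s := by
    intro s; rw [mul_pow, ← pow_mul, ← pow_mul]; ring
  simp only [e]
  have hone : q ^ a * (q⁻¹) ^ b = 1 ↔ a % m = b % m := by
    rw [inv_pow, mul_inv_eq_one₀ (pow_ne_zero _ h0)]
    have hmod : ∀ n, q ^ (n % m) = q ^ n := fun n => by
      conv_rhs => rw [← Nat.mod_add_div n m, pow_add, pow_mul, hq.pow_eq_one, one_pow, mul_one]
    rw [← hmod a, ← hmod b]
    exact ⟨fun h => hq.pow_inj (Nat.mod_lt _ (by omega)) (Nat.mod_lt _ (by omega)) h,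
      fun h => by rw [h]⟩
  split_ifs with h
  · rw [hone.mpr h]; simp [hm0]
  · have hne : q ^ a * (q⁻¹) ^ b ≠ 1 := fun h' => h (hone.mp h')
    have hp : (q ^ a * (q⁻¹) ^ b) ^ m = 1 := by
      rw [mul_pow, ← pow_mul, ← pow_mul, mul_comm a, mul_comm b, pow_mul, pow_mul, inv_pow,
        hq.pow_eq_one]; simp
    rw [geom_sum_eq hne, hp]; simp

theorem chi_idem (a b : ℕ) :
    chi hg hG hq hm a (idem m q g b) = if a % m = b % m then 1 else 0 := by
  rw [← orth hq hm a b]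
  simp only [idem, map_smul, map_sum, chi_of, smul_eq_mul]

theorem exists_pow (hg : ∀ x, x ∈ Subgroup.zpowers g) (hG : Nat.card G = m) (hm : 2 ≤ m)
    (x : G) : ∃ s < m, g ^ s = x := by
  classical
  have ho : orderOf g = m := by rw [orderOf_eq_card_of_forall_mem_zpowers hg, hG]
  have : IsOfFinOrder g := orderOf_pos_iff.mp (by omega)
  obtain ⟨s, hs, h⟩ := this.mem_zpowers_iff_mem_range_orderOf.mp (hg x) |> Finset.mem_image.mp
  exact ⟨s, by simpa [ho] using hs, h⟩

theorem reconstruct (x : MonoidAlgebra k G) :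
    x = ∑ j ∈ Finset.range m, chi hg hG hq hm j x • idem m q g j := by
  induction x using MonoidAlgebra.induction_on with
  | of x =>
    obtain ⟨s, hs, rfl⟩ := exists_pow hg hG hm x
    simp only [chi_of, idem, Finset.smul_sum, smul_smul]
    rw [Finset.sum_comm]
    have h0 : q ≠ 0 := hq.ne_zero (by omega)
    have : ∀ t ∈ Finset.range m, ∑ j ∈ Finset.range m,
        (q ^ (j * s) * ((m : k)⁻¹ * (q⁻¹) ^ (j * t))) • MonoidAlgebra.of k G (g ^ t) =
        if s = t then MonoidAlgebra.of k G (g ^ t) else 0 := by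
      intro t ht
      rw [← Finset.sum_smul]
      have h := orth hq hm s t
      rw [Nat.mod_eq_of_lt hs, Nat.mod_eq_of_lt (by simpa using ht)] at h
      rw [Finset.mul_sum] at h
      have h' : ∑ j ∈ Finset.range m, q ^ (j * s) * ((m : k)⁻¹ * (q⁻¹) ^ (j * t)) =
          if s = t then 1 else 0 := by
        rw [← h]; refine Finset.sum_congr rfl fun j _ => ?_
        rw [mul_comm j s, mul_comm j t]; ring
      rw [h']; split_ifs <;> simp
    rw [Finset.sum_congr rfl this]
    simp [hs]
  | add x y hx hy =>
    simp only [map_add, add_smul, Finset.sum_add_distrib]; rw [← hx, ← hy]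
  | smul r x hx =>
    simp only [map_smul, smul_assoc, ← Finset.smul_sum]; rw [← hx]

theorem sep_H {x y : MonoidAlgebra k G}
    (h : ∀ a < m, chi hg hG hq hm a x = chi hg hG hq hm a y) : x = y := by
  rw [reconstruct hg hG hq hm x, reconstruct hg hG hq hm y]
  exact Finset.sum_congr rfl fun a ha => by rw [h a (by simpa using ha)]

theorem sep_tensor {K ι : Type*} [Semiring K] [Algebra k K] (f : ι → K →ₐ[k] k)
    (hf : ∀ x y, (∀ i, f i x = f i y) → x = y) {x y : MonoidAlgebra k G ⊗[k] K}
    (h : ∀ a < m, ∀ i, productMap (chi hg hG hq hm a) (f i) x =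
      productMap (chi hg hG hq hm a) (f i) y) : x = y := by
  let p : ℕ → MonoidAlgebra k G ⊗[k] K →ₗ[k] K := fun a =>
    (TensorProduct.lid k K).toLinearMap ∘ₗ (chi hg hG hq hm a).toLinearMap.rTensor K
  have hp : ∀ a i z, f i (p a z) = productMap (chi hg hG hq hm a) (f i) z := by
    intro a i z
    induction z with
    | zero => simp
    | tmul u v => simp [p]
    | add u v hu hv => rw [map_add, map_add, map_add, hu, hv]
  have hrec : ∀ z, z = ∑ j ∈ Finset.range m, idem m q g j ⊗ₜ[k] p j z := by
    intro z
    induction z with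
    | zero => simp
    | tmul u v =>
      conv_lhs => rw [reconstruct hg hG hq hm u, TensorProduct.sum_tmul]
      exact Finset.sum_congr rfl fun j _ => by simp [p, TensorProduct.smul_tmul]
    | add u v hu hv =>
      simp only [map_add, TensorProduct.tmul_add, Finset.sum_add_distrib]; rw [← hu, ← hv]
  rw [hrec x, hrec y]
  refine Finset.sum_congr rfl fun a ha => ?_
  rw [hf (p a x) (p a y) fun i => by rw [hp, hp, h a (by simpa using ha) i]]

theorem eval_reassociator (r : k) (c a b d : ℕ) :
    productMap (chi hg hG hq hm a) (productMap (chi hg hG hq hm b) (chi hg hG hq hm d))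
      (∑ i ∈ Finset.range m, ∑ j ∈ Finset.range m, ∑ l ∈ Finset.range m,
        r ^ (c * i * ((j + l) / m)) •
          (idem m q g i ⊗ₜ[k] (idem m q g j ⊗ₜ[k] idem m q g l))) =
      r ^ (c * (a % m) * ((b % m + d % m) / m)) := by
  have hm' : 0 < m := by omega
  simp only [map_sum, map_smul, Algebra.TensorProduct.productMap_apply_tmul, chi_idem]
  rw [Finset.sum_eq_single (a % m), Finset.sum_eq_single (b % m), Finset.sum_eq_single (d % m)]
  · simp
  · intro l hl hne
    rw [Nat.mod_eq_of_lt (Finset.mem_range.mp hl)]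
    simp [hne.symm]
  · intro h; exact absurd (Finset.mem_range.mpr (Nat.mod_lt _ hm')) h
  · intro l hl hne
    rw [Nat.mod_eq_of_lt (Finset.mem_range.mp hl)]
    simp [hne.symm]
  · intro h; exact absurd (Finset.mem_range.mpr (Nat.mod_lt _ hm')) h
  · intro l hl hne
    rw [Nat.mod_eq_of_lt (Finset.mem_range.mp hl)]
    simp [hne.symm]
  · intro h; exact absurd (Finset.mem_range.mpr (Nat.mod_lt _ hm')) h

theorem sep_H3 {x y : MonoidAlgebra k G ⊗[k] (MonoidAlgebra k G ⊗[k] MonoidAlgebra k G)}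
    (h : ∀ a b d : ℕ,
      productMap (chi hg hG hq hm a) (productMap (chi hg hG hq hm b) (chi hg hG hq hm d)) x =
      productMap (chi hg hG hq hm a) (productMap (chi hg hG hq hm b) (chi hg hG hq hm d)) y) :
    x = y := by
  refine sep_tensor hg hG hq hm
    (fun p : ℕ × ℕ => productMap (chi hg hG hq hm p.1) (chi hg hG hq hm p.2)) ?_
    fun a _ p => h a p.1 p.2
  intro x y h
  exact sep_tensor hg hG hq hm (chi hg hG hq hm)
    (fun x y h => sep_H hg hG hq hm fun a _ => h a) fun a _ b => h (a, b)

theorem sep_H4 {x y : MonoidAlgebra k G ⊗[k]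
      (MonoidAlgebra k G ⊗[k] (MonoidAlgebra k G ⊗[k] MonoidAlgebra k G))}
    (h : ∀ a b d e : ℕ,
      productMap (chi hg hG hq hm a) (productMap (chi hg hG hq hm b)
        (productMap (chi hg hG hq hm d) (chi hg hG hq hm e))) x =
      productMap (chi hg hG hq hm a) (productMap (chi hg hG hq hm b)
        (productMap (chi hg hG hq hm d) (chi hg hG hq hm e))) y) :
    x = y := by
  refine sep_tensor hg hG hq hm
    (fun p : ℕ × ℕ × ℕ => productMap (chi hg hG hq hm p.1)
      (productMap (chi hg hG hq hm p.2.1) (chi hg hG hq hm p.2.2))) ?_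
    fun a _ p => h a p.1 p.2.1 p.2.2
  intro x y h
  exact sep_H3 hg hG hq hm fun a b d => h (a, b, d)

/-- `Φ_c` is invertible. -/
def reassociatorUnit (c : ℕ) :
    (MonoidAlgebra k G ⊗[k] (MonoidAlgebra k G ⊗[k] MonoidAlgebra k G))ˣ where
  val := reassociator m q g c
  inv := ∑ i ∈ Finset.range m, ∑ j ∈ Finset.range m, ∑ l ∈ Finset.range m,
    (q⁻¹) ^ (c * i * ((j + l) / m)) • (idem m q g i ⊗ₜ (idem m q g j ⊗ₜ idem m q g l))
  val_inv := by
    refine sep_H3 hg hG hq hm fun a b d => ?_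
    have h0 : q ≠ 0 := hq.ne_zero (by omega)
    rw [map_mul, reassociator, eval_reassociator, eval_reassociator, ← mul_pow,
      mul_inv_cancel₀ h0, one_pow, map_one]
  inv_val := by
    refine sep_H3 hg hG hq hm fun a b d => ?_
    have h0 : q ≠ 0 := hq.ne_zero (by omega)
    rw [map_mul, reassociator, eval_reassociator, eval_reassociator, ← mul_pow,
      inv_mul_cancel₀ h0, one_pow, map_one]

theorem chi_comul (a b : ℕ) :
    (productMap (chi hg hG hq hm a) (chi hg hG hq hm b)).comp
      (Bialgebra.comulAlgHom k (MonoidAlgebra k G)) = chi hg hG hq hm (a + b) := by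
  refine MonoidAlgebra.algHom_ext (fun x => ?_) (Subsingleton.elim _ _)
  obtain ⟨s, -, rfl⟩ := exists_pow hg hG hm x
  have h := fun a => chi_of hg hG hq hm a s
  simp only [MonoidAlgebra.of_apply] at h
  simp [h, add_mul, pow_add]

theorem chi_zero : Bialgebra.counitAlgHom k (MonoidAlgebra k G) = chi hg hG hq hm 0 := by
  refine MonoidAlgebra.algHom_ext (fun x => ?_) (Subsingleton.elim _ _)
  obtain ⟨s, -, rfl⟩ := exists_pow hg hG hm x
  have h := fun a => chi_of hg hG hq hm a s
  simp only [MonoidAlgebra.of_apply] at h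
  simp [h]

theorem chi_antipode (a : ℕ) (x : MonoidAlgebra k G) :
    chi hg hG hq hm a (HopfAlgebra.antipode k x) = chi hg hG hq hm ((m - 1) * a) x := by
  induction x using MonoidAlgebra.induction_on with
  | of x =>
    obtain ⟨s, -, rfl⟩ := exists_pow hg hG hm x
    have ho : g ^ m = 1 := by
      rw [← hG, ← orderOf_eq_card_of_forall_mem_zpowers hg, pow_orderOf_eq_one]
    have hi : (g ^ s)⁻¹ = g ^ ((m - 1) * s) := by
      rw [inv_eq_iff_mul_eq_one, ← pow_add, add_comm, ← Nat.succ_mul,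
        show (m - 1).succ = m by omega, pow_mul, ho, one_pow]
    rw [MonoidAlgebra.of_apply, MonoidAlgebra.antipode_single, hi]
    have h := fun s => chi_of hg hG hq hm a s
    have h' := chi_of hg hG hq hm ((m - 1) * a) s
    simp only [MonoidAlgebra.of_apply] at h h'
    rw [h']
    simp [h]
    ring_nf
  | add x y hx hy => simp [hx, hy]
  | smul r x hx => simp [hx]

end Lemmas

section Quasi

variable {m : ℕ} {q : k} {g : G} (hg : ∀ x, x ∈ Subgroup.zpowers g) (hG : Nat.card G = m)
    (hq : IsPrimitiveRoot q m) (hm : 2 ≤ m)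

theorem productMap_comp_map {A B A' B' : Type*} [Semiring A] [Algebra k A] [Semiring B]
    [Algebra k B] [Semiring A'] [Algebra k A'] [Semiring B'] [Algebra k B']
    (f : A' →ₐ[k] k) (g : B' →ₐ[k] k) (u : A →ₐ[k] A') (v : B →ₐ[k] B') :
    (productMap f g).comp (Algebra.TensorProduct.map u v) =
      productMap (f.comp u) (g.comp v) :=
  Algebra.TensorProduct.ext' fun a b => by simp

theorem productMap_comp_assoc {A B C : Type*} [Semiring A] [Algebra k A] [Semiring B]
    [Algebra k B] [Semiring C] [Algebra k C]
    (f : A →ₐ[k] k) (g : B →ₐ[k] k) (h : C →ₐ[k] k) :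
    (productMap f (productMap g h)).comp (Algebra.TensorProduct.assoc k k k A B C).toAlgHom =
      productMap (productMap f g) h := by
  ext <;> simp [Algebra.TensorProduct.one_def]

theorem carry (m a b d : ℕ) (hm : 2 ≤ m) :
    ((a + b) % m + d % m) / m + (a % m + b % m) / m =
      (a % m + (b + d) % m) / m + (b % m + d % m) / m := by
  have hm' : 0 < m := by omega
  have key : ∀ x y z, x < m → ((x + y) % m + z) / m + (x + y) / m = (x + y + z) / m := by
    intro x y z _
    conv_rhs => rw [← Nat.mod_add_div (x + y) m, show (x + y) % m + m * ((x + y) / m) + z =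
      (x + y) % m + z + m * ((x + y) / m) by ring, Nat.add_mul_div_left _ _ hm']
  have h1 := key (a % m) (b % m) (d % m) (Nat.mod_lt _ hm')
  have h2 := key (b % m) (d % m) (a % m) (Nat.mod_lt _ hm')
  rw [← Nat.add_mod] at h1 h2
  rw [h1, add_comm (a % m) ((b + d) % m), h2]
  congr 1; ring

theorem pentagon_aux (hq : IsPrimitiveRoot q m) (hm : 2 ≤ m) (c a b d e : ℕ) :
    q ^ (c * (b % m) * ((d % m + e % m) / m)) *
      q ^ (c * (a % m) * (((b + d) % m + e % m) / m)) *
      q ^ (c * (a % m) * ((b % m + d % m) / m)) =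
    q ^ (c * (a % m) * ((b % m + (d + e) % m) / m)) *
      q ^ (c * ((a + b) % m) * ((d % m + e % m) / m)) := by
  have hr : ∀ x y, q ^ (c * (x % m) * y) = q ^ (c * x * y) := by
    intro x y
    conv_rhs => rw [← Nat.mod_add_div x m, show c * (x % m + m * (x / m)) * y =
      c * (x % m) * y + m * (c * (x / m) * y) by ring, pow_add, pow_mul q m, hq.pow_eq_one,
      one_pow, mul_one]
  simp only [hr, ← pow_add]
  congr 1
  have h := carry m b d e hm
  generalize ((b + d) % m + e % m) / m = A at *
  generalize (b % m + d % m) / m = B at *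
  generalize (b % m + (d + e) % m) / m = C at *
  generalize (d % m + e % m) / m = D at *
  calc c * b * D + c * a * A + c * a * B = c * b * D + c * a * (A + B) := by ring
    _ = _ := by rw [h]; ring

/-- `k[G]` with the reassociator `Φ_c`, as a quasi-bialgebra. -/
def cyclicQuasiBialgebra (c : ℕ) : QuasiBialgebra k (MonoidAlgebra k G) where
  comul := Bialgebra.comulAlgHom k (MonoidAlgebra k G)
  counit := Bialgebra.counitAlgHom k (MonoidAlgebra k G)
  Phi := reassociatorUnit hg hG hq hm c
  quasi_coassoc := by
    intro h
    rw [mul_comm (reassociatorUnit hg hG hq hm c).val, mul_assoc, Units.mul_inv, mul_one]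
    exact (Coalgebra.coassoc_apply h).symm
  id_counit_comul := by
    intro h
    have := Coalgebra.lTensor_counit_comul (R := k) h
    refine (congrArg (Algebra.TensorProduct.rid k k (MonoidAlgebra k G)) this).trans ?_
    simp
  counit_id_comul := by
    intro h
    have := Coalgebra.rTensor_counit_comul (R := k) h
    refine (congrArg (Algebra.TensorProduct.lid k (MonoidAlgebra k G)) this).trans ?_
    simp
  pentagon := by
    refine sep_H4 hg hG hq hm fun a b d e => ?_
    let X := chi hg hG hq hm
    let Δ := Bialgebra.comulAlgHom k (MonoidAlgebra k G)
    have hΔ : ∀ a b x, productMap (X a) (X b) (Δ x) = X (a + b) x := fun a b x =>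
      DFunLike.congr_fun (chi_comul hg hG hq hm a b) x
    have e1 : ∀ z, productMap (X a) (productMap (X b) (productMap (X d) (X e)))
        ((1 : MonoidAlgebra k G) ⊗ₜ[k] z) = productMap (X b) (productMap (X d) (X e)) z := by
      intro z; simp
    have e2 : (productMap (X a) (productMap (X b) (productMap (X d) (X e)))).comp
        (Algebra.TensorProduct.map (AlgHom.id k _)
        ((Algebra.TensorProduct.assoc k k k _ _ _).toAlgHom.comp
          (Algebra.TensorProduct.map Δ (AlgHom.id k _)))) =
        productMap (X a) (productMap (X (b + d)) (X e)) := by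
      rw [productMap_comp_map, ← AlgHom.comp_assoc, productMap_comp_assoc, productMap_comp_map,
        chi_comul]
      rfl
    have e3 : (productMap (X a) (productMap (X b) (productMap (X d) (X e)))).comp
        (Algebra.TensorProduct.map (AlgHom.id k _)
        (Algebra.TensorProduct.map (AlgHom.id k _)
          Algebra.TensorProduct.includeLeft)) =
        productMap (X a) (productMap (X b) (X d)) := by
      rw [productMap_comp_map, productMap_comp_map]
      congr 2
      ext
      simp
    have e4 : (productMap (X a) (productMap (X b) (productMap (X d) (X e)))).comp
        (Algebra.TensorProduct.map (AlgHom.id k _)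
        (Algebra.TensorProduct.map (AlgHom.id k _) Δ)) =
        productMap (X a) (productMap (X b) (X (d + e))) := by
      rw [productMap_comp_map, productMap_comp_map, chi_comul]
      rfl
    have e5 : (productMap (X a) (productMap (X b) (productMap (X d) (X e)))).comp
        ((Algebra.TensorProduct.assoc k k k _ _ _).toAlgHom.comp
        (Algebra.TensorProduct.map Δ (AlgHom.id k _))) =
        productMap (X (a + b)) (productMap (X d) (X e)) := by
      rw [← AlgHom.comp_assoc, productMap_comp_assoc, productMap_comp_map, chi_comul]
      rfl
    have hP : ∀ a b d, productMap (X a) (productMap (X b) (X d))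
        (reassociatorUnit hg hG hq hm c).val = q ^ (c * (a % m) * ((b % m + d % m) / m)) :=
      fun a b d => eval_reassociator hg hG hq hm q c a b d
    have e2' := DFunLike.congr_fun e2 (reassociatorUnit hg hG hq hm c).val
    have e3' := DFunLike.congr_fun e3 (reassociatorUnit hg hG hq hm c).val
    have e4' := DFunLike.congr_fun e4 (reassociatorUnit hg hG hq hm c).val
    have e5' := DFunLike.congr_fun e5 (reassociatorUnit hg hG hq hm c).val
    rw [hP] at e2' e3' e4' e5'
    have e1' := (e1 (reassociatorUnit hg hG hq hm c).val).trans (hP b d e)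
    rw [map_mul, map_mul, map_mul]
    refine (congrArg₂ (· * ·) (congrArg₂ (· * ·) e1' e2') e3').trans ?_
    refine Eq.trans ?_ (congrArg₂ (· * ·) e4' e5').symm
    exact pentagon_aux hq hm c a b d e
  normalized := by
    refine sep_tensor hg hG hq hm (chi hg hG hq hm)
      (fun x y h => sep_H hg hG hq hm fun a _ => h a) fun a _ b => ?_
    have e : (productMap (chi hg hG hq hm a) (chi hg hG hq hm b)).comp
        (Algebra.TensorProduct.map (AlgHom.id k _)
        ((Algebra.TensorProduct.lid k _).toAlgHom.comp
        (Algebra.TensorProduct.map (Bialgebra.counitAlgHom k (MonoidAlgebra k G))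
          (AlgHom.id k _)))) =
        productMap (chi hg hG hq hm a) (productMap (chi hg hG hq hm 0) (chi hg hG hq hm b)) := by
      rw [productMap_comp_map, ← chi_zero hg hG hq hm]
      congr 1
      exact Algebra.TensorProduct.ext' fun x y => by simp
    rw [map_one]
    refine (DFunLike.congr_fun e (reassociatorUnit hg hG hq hm c).val).trans ?_
    refine (eval_reassociator hg hG hq hm q c a 0 b).trans ?_
    rw [Nat.zero_mod, zero_add, Nat.div_eq_of_lt (Nat.mod_lt _ (by omega)), mul_zero, pow_zero]

theorem mulRight_one_comp (S : MonoidAlgebra k G →ₗ[k] MonoidAlgebra k G) :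
    mulRight k (1 : MonoidAlgebra k G) ∘ₗ S = S := by
  ext x; simp

theorem chi_beta (a c : ℕ) (ha : a < m) :
    chi hg hG hq hm a (∑ j ∈ Finset.range m, (q⁻¹) ^ (c * j) • idem m q g j) =
      (q⁻¹) ^ (c * a) := by
  simp only [map_sum, map_smul, chi_idem]
  rw [Finset.sum_eq_single a]
  · simp
  · intro b hb hne
    rw [Nat.mod_eq_of_lt ha, Nat.mod_eq_of_lt (Finset.mem_range.mp hb)]
    simp [hne.symm]
  · intro h; exact absurd (Finset.mem_range.mpr ha) h

theorem neg_mod_add (a : ℕ) (ha : a < m) :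
    ((m - 1) * a % m + a % m) / m = if a = 0 then 0 else 1 := by
  split_ifs with h
  · subst h; simp
  · have h1 : (m - 1) * a % m = m - a := by
      have e : (m - 1) * a = (m - a) + m * (a - 1) := by
        zify [show 1 ≤ m by omega, ha.le, show 1 ≤ a by omega]; ring
      rw [e, Nat.add_mul_mod_self_left, Nat.mod_eq_of_lt (by omega)]
    rw [h1, Nat.mod_eq_of_lt ha, Nat.sub_add_cancel ha.le, Nat.div_self (by omega)]

/-- The quasi-Hopf algebra `k_{Φ_c}[G]`: the group Hopf algebra `k[G]` of the cyclic group
`G = ⟨g⟩` of order `m`, with reassociator `Φ_c`, `S(x) = x⁻¹` for `x ∈ G`, `α = 1` and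
`β = ∑_j q^{-cj} 1_j`. -/
def cyclicQuasiHopf (c : ℕ) : QuasiHopfAlgebra k (MonoidAlgebra k G) where
  toQuasiBialgebra := cyclicQuasiBialgebra hg hG hq hm c
  S := HopfAlgebra.antipode k
  alpha := 1
  beta := ∑ j ∈ Finset.range m, (q⁻¹) ^ (c * j) • idem m q g j
  S_one := HopfAlgebra.antipode_one
  S_mul a b := by rw [HopfAlgebra.antipode_mul_distrib, mul_comm]
  antipode_alpha := by
    intro h
    rw [mulRight_one_comp]
    refine (HopfAlgebra.mul_antipode_rTensor_comul_apply (R := k) h).trans ?_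
    rw [Algebra.algebraMap_eq_smul_one]
    rfl
  antipode_beta := by
    intro h
    generalize (∑ j ∈ Finset.range m, (q⁻¹) ^ (c * j) • idem m q g j) = β
    have e : ∀ z : MonoidAlgebra k G ⊗[k] MonoidAlgebra k G,
        mul' k _ (TensorProduct.map (mulRight k β) (HopfAlgebra.antipode k) z) =
          β * mul' k _ ((HopfAlgebra.antipode k).lTensor _ z) := by
      intro z
      induction z with
      | zero => simp
      | tmul x y => simp; ring
      | add x y hx hy => simp only [map_add, mul_add, hx, hy]
    refine (e _).trans ?_
    refine (congrArg (β * ·) (HopfAlgebra.mul_antipode_lTensor_comul_apply (R := k) h)).trans ?_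
    rw [Algebra.algebraMap_eq_smul_one, mul_smul_comm, mul_one]
    rfl
  beta_S_alpha := by
    rw [mulRight_one_comp]
    refine sep_H hg hG hq hm fun a ha => ?_
    generalize hβ : (∑ j ∈ Finset.range m, (q⁻¹) ^ (c * j) • idem m q g j) = β
    have e : ∀ z : MonoidAlgebra k G ⊗[k] (MonoidAlgebra k G ⊗[k] MonoidAlgebra k G),
        chi hg hG hq hm a (mul' k _ (TensorProduct.map (mulRight k β)
          (mul' k _ ∘ₗ TensorProduct.map (HopfAlgebra.antipode k) LinearMap.id) z)) =
        chi hg hG hq hm a β * productMap (chi hg hG hq hm a)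
          (productMap (chi hg hG hq hm ((m - 1) * a)) (chi hg hG hq hm a)) z := by
      intro z
      induction z with
      | zero => simp
      | tmul x y =>
        induction y with
        | zero => simp
        | tmul y z => simp [chi_antipode]; ring
        | add x y hx hy => simp only [map_add, mul_add, TensorProduct.tmul_add, hx, hy]
      | add x y hx hy => simp only [map_add, mul_add, hx, hy]
    refine (e _).trans ?_
    rw [← hβ, chi_beta hg hG hq hm a c ha, map_one]
    refine (congrArg ((q⁻¹) ^ (c * a) * ·)
      (eval_reassociator hg hG hq hm q c a ((m - 1) * a) a)).trans ?_
    have h0 : q ≠ 0 := hq.ne_zero (by omega)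
    simp only [neg_mod_add a ha]
    simp only [Nat.mod_eq_of_lt ha]
    split_ifs with h
    · simp [h]
    · rw [mul_one, ← mul_pow, inv_mul_cancel₀ h0, one_pow]
  S_alpha_beta := by
    rw [mulRight_one_comp]
    refine sep_H hg hG hq hm fun a ha => ?_
    generalize hβ : (∑ j ∈ Finset.range m, (q⁻¹) ^ (c * j) • idem m q g j) = β
    have e : ∀ z : MonoidAlgebra k G ⊗[k] (MonoidAlgebra k G ⊗[k] MonoidAlgebra k G),
        chi hg hG hq hm a (mul' k _ (TensorProduct.map (HopfAlgebra.antipode k)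
          (mul' k _ ∘ₗ TensorProduct.map (mulRight k β) (HopfAlgebra.antipode k)) z)) =
        chi hg hG hq hm a β * productMap (chi hg hG hq hm ((m - 1) * a))
          (productMap (chi hg hG hq hm a) (chi hg hG hq hm ((m - 1) * a))) z := by
      intro z
      induction z with
      | zero => simp
      | tmul x y =>
        induction y with
        | zero => simp
        | tmul y z => simp [chi_antipode]; ring
        | add x y hx hy => simp only [map_add, mul_add, TensorProduct.tmul_add, hx, hy]
      | add x y hx hy => simp only [map_add, mul_add, hx, hy]
    refine (e _).trans ?_
    rw [← hβ, chi_beta hg hG hq hm a c ha, map_one]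
    refine (congrArg ((q⁻¹) ^ (c * a) * ·)
      (eval_reassociator hg hG hq hm (q⁻¹) c ((m - 1) * a) a ((m - 1) * a))).trans ?_
    have hq' : (q⁻¹) ^ m = 1 := by rw [inv_pow, hq.pow_eq_one, inv_one]
    simp only [add_comm (a % m), neg_mod_add a ha]
    split_ifs with h
    · simp [h]
    · have h1 : (m - 1) * a % m = m - a := by
        have e : (m - 1) * a = (m - a) + m * (a - 1) := by
          zify [show 1 ≤ m by omega, ha.le, show 1 ≤ a by omega]; ring
        rw [e, Nat.add_mul_mod_self_left, Nat.mod_eq_of_lt (by omega)]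
      rw [h1, mul_one, ← pow_add, ← mul_add, show a + (m - a) = m by omega, mul_comm, pow_mul,
        hq', one_pow]

end Quasi

/-- `v = ∑_{j=1}^m 𝔮^{mλj + cfj} 1_j`, where `1_j` is formed with `q = 𝔮 ^ m`
(so `1_m = 1_0`). -/
def cyclicV (m : ℕ) (𝔮 : k) (g : G) (c f lam : ℕ) : MonoidAlgebra k G :=
  ∑ j ∈ Finset.Icc 1 m, 𝔮 ^ (m * lam * j + c * f * j) • idem m (𝔮 ^ m) g j

section Main

variable {m : ℕ} {𝔮 : k} {g : G} (hg : ∀ x, x ∈ Subgroup.zpowers g) (hG : Nat.card G = m)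
    (hm : 2 ≤ m) (h𝔮 : IsPrimitiveRoot 𝔮 (m ^ 2))

theorem isPrimitiveRoot_pow (hm : 2 ≤ m) (h𝔮 : IsPrimitiveRoot 𝔮 (m ^ 2)) :
    IsPrimitiveRoot (𝔮 ^ m) m :=
  h𝔮.pow (pow_pos (by omega) 2) (sq m)

/-- `k_{Φ_c}[G]`, with `q = 𝔮 ^ m`, for `𝔮` a primitive root of unity of order `m²`. The
Yetter-Drinfeld notions only use the underlying quasi-bialgebra. -/
def kPhi (c : ℕ) : QuasiBialgebra k (MonoidAlgebra k G) :=
  (cyclicQuasiHopf hg hG (isPrimitiveRoot_pow hm h𝔮) hm c).toQuasiBialgebra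

/-- The algebra morphism `σ : k[G] → k` with `σ(g^j) = q^{fj}`, where `q = 𝔮 ^ m`. -/
def cyclicSigma (f : ℕ) : MonoidAlgebra k G →ₐ[k] k :=
  chi hg hG (isPrimitiveRoot_pow hm h𝔮) hm f

theorem cyclicSigma_of (f j : ℕ) :
    cyclicSigma hg hG hm h𝔮 f (MonoidAlgebra.of k G (g ^ j)) = (𝔮 ^ m) ^ (f * j) :=
  chi_of hg hG (isPrimitiveRoot_pow hm h𝔮) hm f j

end Main

/-- `λ f / m + c f² / m² - 1 / 2 ∈ ℤ`. -/
def CyclicCond (m c f lam : ℕ) : Prop :=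
  ∃ z : ℤ, (lam : ℚ) * f / m + (c : ℚ) * f ^ 2 / m ^ 2 - 1 / 2 = z

end Cyclic

end YD

end

open scoped TensorProduct

noncomputable section

namespace YD

open LinearMap (mulRight mul')
open Algebra.TensorProduct (productMap)

/-! ### Yetter-Drinfeld operations on simultaneous eigenvectors -/

section Eigen

variable {k H : Type*} [Field k] [Ring H] [Algebra k H]
variable {M N P : Type*} [AddCommGroup M] [Module k M] [AddCommGroup N] [Module k N]
  [AddCommGroup P] [Module k P]

/-! Since `k` contains the `m`-th roots of unity, `k[G]` is split semisimple: an identity in a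
tensor power of `k[G]` can be tested on the characters `χ_a : g ↦ q^a`. Under these, `Δ` becomes
addition of indices and `Φ_c` becomes the scalar 3-cocycle `Φ(a,b,d) = q^(c a ⌊(b+d)/m⌋)` for
reduced indices. On eigenvectors of `G` all associators are therefore scalars, and the braided
axioms turn into scalar equations.

Let `B` be a 2-dimensional braided Hopf algebra. The line `ker ε = k n` is stable under action and
coaction, so `g n = q^f n` and `n ↦ v ⊗ n`; moreover `n² = a n` and `Δ(n) = n ⊗ 1 + 1 ⊗ n + b n ⊗
n`. If `f = 0`, multiplicativity of `Δ` gives `(ab + 1)(ab + 2) = 0`, the antipode excludes `ab =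
-1`, and colinearity of the product forces `v = 1`. Then `1 + b n` is group-like of order two and
`B` is the trivial `k[C₂]`. If `f ≠ 0`, equivariance kills `a` and `b`, and the `n ⊗ n` term of
`Δ(n²) = 0` reads `1 + χ_f(v) = 0`. Hence `B ≅ B_{σ,v}` with `σ = χ_f`
(`StructureConstants.isomorphic_Bsv`). Conversely, the same scalar equations suffice for `B_{σ,v}`
to be a braided Hopf algebra (`Bsv_isBraidedHopfAlgebra`).

It remains to find all `v`. Coassociativity of the coaction says that `a ↦ χ_a(v)` is a character
twisted by the carry of `a + b` modulo `m` (`twistedCharacter_iff`). Thus `χ_a(v) = w^a` for `a <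
m`, with `w^m = q^(cf)`, which gives `w = 𝔮^(mλ + cf)`. The condition `χ_f(v) = -1` becomes `𝔮^((mλ
+ cf) f) = -1`, and this is `(*)` (`cyclicCond_iff_pow`). Completing a square in `(*)` shows that
`c` and `m` are even; for even `c` and `m`, `f = m/2` gives a solution. -/

theorem tensorAct_tmul_tmul {K : Type*} [Ring K] [Algebra k K]
    (r : H →ₐ[k] Module.End k M) (s : K →ₐ[k] Module.End k N) (x : H) (y : K) (m : M) (n : N) :
    tensorAct r s (x ⊗ₜ y) (m ⊗ₜ n) = r x m ⊗ₜ s y n := by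
  simp [tensorAct, Module.endTensorEndAlgHom]

theorem actThenMul_tmul (r : H →ₐ[k] Module.End k M) (d : M →ₗ[k] H ⊗[k] M) (x y : H) (m : M) :
    actThenMul r d (x ⊗ₜ y) m = (mulRight k y).rTensor M (d (r x m)) := by
  simp [actThenMul]

/-- The contraction `X ↦ X¹ ⊗ X² β(X³)`. -/
def contract3 (β : H →ₐ[k] k) : H ⊗[k] (H ⊗[k] H) →ₐ[k] H ⊗[k] H :=
  Algebra.TensorProduct.map (AlgHom.id k H)
    ((Algebra.TensorProduct.rid k k H).toAlgHom.comp
      (Algebra.TensorProduct.map (AlgHom.id k H) β))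

/-- The contraction `X ↦ X¹ ⊗ β(X²) X³`. -/
def contract2 (β : H →ₐ[k] k) : H ⊗[k] (H ⊗[k] H) →ₐ[k] H ⊗[k] H :=
  Algebra.TensorProduct.map (AlgHom.id k H)
    ((Algebra.TensorProduct.lid k H).toAlgHom.comp
      (Algebra.TensorProduct.map β (AlgHom.id k H)))

/-- The contraction `X ↦ β(X¹) X² ⊗ X³`. -/
def contract1 (β : H →ₐ[k] k) : H ⊗[k] (H ⊗[k] H) →ₐ[k] H ⊗[k] H :=
  (Algebra.TensorProduct.lid k (H ⊗[k] H)).toAlgHom.comp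
    (Algebra.TensorProduct.map β (AlgHom.id k (H ⊗[k] H)))

/-- The contraction `x ↦ α(x¹) x²`. -/
def contractLeft (α : H →ₐ[k] k) : H ⊗[k] H →ₐ[k] H :=
  (Algebra.TensorProduct.lid k H).toAlgHom.comp
    (Algebra.TensorProduct.map α (AlgHom.id k H))

/-- The contraction `x ↦ x¹ α(x²)`. -/
def contractRight (α : H →ₐ[k] k) : H ⊗[k] H →ₐ[k] H :=
  (Algebra.TensorProduct.rid k k H).toAlgHom.comp
    (Algebra.TensorProduct.map (AlgHom.id k H) α)

@[simp] theorem contract3_tmul (β : H →ₐ[k] k) (x y z : H) :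
    contract3 β (x ⊗ₜ (y ⊗ₜ z)) = β z • (x ⊗ₜ y) := by
  simp [contract3]

@[simp] theorem contract2_tmul (β : H →ₐ[k] k) (x y z : H) :
    contract2 β (x ⊗ₜ (y ⊗ₜ z)) = β y • (x ⊗ₜ z) := by
  simp [contract2]

@[simp] theorem contract1_tmul (β : H →ₐ[k] k) (x : H) (y : H ⊗[k] H) :
    contract1 β (x ⊗ₜ y) = β x • y := by
  simp [contract1]

@[simp] theorem contractLeft_tmul (β : H →ₐ[k] k) (x y : H) :
    contractLeft β (x ⊗ₜ y) = β x • y := by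
  simp [contractLeft]

@[simp] theorem contractRight_tmul (β : H →ₐ[k] k) (x y : H) :
    contractRight β (x ⊗ₜ y) = β y • x := by
  simp [contractRight]

/-- This is the source of all scalars below: on eigenvectors an associativity constraint is
evaluation of `Φ` at a triple of characters. -/
theorem tensorAct_eigen {K : Type*} [Ring K] [Algebra k K]
    {r : H →ₐ[k] Module.End k M} {s : K →ₐ[k] Module.End k N} {α : H →ₐ[k] k} {β : K →ₐ[k] k}
    {m : M} {n : N} (hm : ∀ x, r x m = α x • m) (hn : ∀ y, s y n = β y • n) (z : H ⊗[k] K) :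
    tensorAct r s z (m ⊗ₜ n) = productMap α β z • (m ⊗ₜ n) := by
  induction z with
  | zero => simp
  | tmul x y => simp [tensorAct_tmul_tmul, hm, hn, TensorProduct.smul_tmul', smul_smul, mul_comm]
  | add x y hx hy => simp [hx, hy, add_smul]

theorem tensorAct_lmul_eigen {s : H →ₐ[k] Module.End k N} {β : H →ₐ[k] k} {n : N}
    (hn : ∀ y, s y n = β y • n) (z : H ⊗[k] H) (h : H) :
    tensorAct (Algebra.lmul k H) s z (h ⊗ₜ n) = (contractRight β z * h) ⊗ₜ n := by
  induction z with
  | zero => simp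
  | tmul x y => simp [tensorAct_tmul_tmul, hn, TensorProduct.smul_tmul']
  | add x y hx hy => simp [hx, hy, add_mul, TensorProduct.add_tmul]

theorem actThenMul_eigen {r : H →ₐ[k] Module.End k M} {d : M →ₗ[k] H ⊗[k] M} {α : H →ₐ[k] k}
    {m : M} {v : H} (hm : ∀ x, r x m = α x • m) (hv : d m = v ⊗ₜ m) (z : H ⊗[k] H) :
    actThenMul r d z m = (v * contractLeft α z) ⊗ₜ m := by
  induction z with
  | zero => simp
  | tmul x y => simp [actThenMul_tmul, hm, hv, TensorProduct.smul_tmul']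
  | add x y hx hy => simp [hx, hy, mul_add, TensorProduct.add_tmul]

/-- The second coaction is applied to `X² · m`, so the leg `X²` turns into the scalar `α(X²)`, while
`v` multiplies `X¹` on the right and `X³` on the left. -/
theorem coassoc_left_eigen {r : H →ₐ[k] Module.End k M} {d : M →ₗ[k] H ⊗[k] M} {α : H →ₐ[k] k}
    {m : M} {v : H} (hm : ∀ x, r x m = α x • m) (hv : d m = v ⊗ₜ m) (z : H ⊗[k] (H ⊗[k] H)) :
    TensorProduct.homTensorHomMap (RingHom.id k) H M H (H ⊗[k] M)
        (TensorProduct.map (LinearMap.mul k H) (actThenMul r d) z) (d m) =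
      TensorProduct.assoc k H H M (((1 ⊗ₜ v) * contract2 α z * (v ⊗ₜ 1)) ⊗ₜ m) := by
  rw [hv]
  induction z with
  | zero => simp
  | tmul x y =>
    induction y with
    | zero => simp
    | tmul y z =>
      simp [actThenMul_tmul, hm, hv, ← TensorProduct.smul_tmul', TensorProduct.tmul_smul]
    | add x y hx hy =>
      simp only [TensorProduct.tmul_add, map_add, LinearMap.add_apply, hx, hy, mul_add, add_mul,
        TensorProduct.add_tmul]
  | add x y hx hy =>
    simp only [map_add, LinearMap.add_apply, hx, hy, mul_add, add_mul, TensorProduct.add_tmul]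

theorem actThenMul_comul_eigen {r : H →ₐ[k] Module.End k M} {e : M →ₗ[k] (H ⊗[k] H) ⊗[k] M}
    {α : H →ₐ[k] k} {m : M} {w : H ⊗[k] H} (hm : ∀ x, r x m = α x • m) (hw : e m = w ⊗ₜ m)
    (z : H ⊗[k] (H ⊗[k] H)) :
    actThenMul r e z m = (w * contract1 α z) ⊗ₜ m := by
  induction z with
  | zero => simp
  | tmul x y => simp [actThenMul, hm, hw, TensorProduct.smul_tmul']
  | add x y hx hy => simp [hx, hy, mul_add, TensorProduct.add_tmul]

theorem coassoc_right_eigen {r : H →ₐ[k] Module.End k M} {α : H →ₐ[k] k} {m : M}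
    (hm : ∀ x, r x m = α x • m) (w : H ⊗[k] H) (z : H ⊗[k] (H ⊗[k] H)) :
    tensorAct (Algebra.lmul k H) (tensorAct (Algebra.lmul k H) r) z
        (TensorProduct.assoc k H H M (w ⊗ₜ m)) =
      TensorProduct.assoc k H H M ((contract3 α z * w) ⊗ₜ m) := by
  induction w with
  | zero => simp
  | add x y hx hy => simp only [TensorProduct.add_tmul, map_add, hx, hy, mul_add]
  | tmul a b =>
    induction z with
    | zero => simp
    | add x y hx hy =>
      simp only [TensorProduct.add_tmul, map_add, LinearMap.add_apply, hx, hy, add_mul]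
    | tmul x y =>
      rw [TensorProduct.assoc_tmul, tensorAct_tmul_tmul, tensorAct_lmul_eigen hm]
      induction y with
      | zero => simp
      | tmul y z => simp [← TensorProduct.smul_tmul', TensorProduct.tmul_smul]
      | add y z hy hz =>
        simp only [TensorProduct.tmul_add, map_add, add_mul, TensorProduct.add_tmul, hy, hz]

namespace QuasiBialgebra

variable (Q : QuasiBialgebra k H)

theorem diagAct_eigen {r : H →ₐ[k] Module.End k M} {s : H →ₐ[k] Module.End k N}
    {α β : H →ₐ[k] k} {m : M} {n : N} (hm : ∀ x, r x m = α x • m) (hn : ∀ y, s y n = β y • n)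
    (h : H) :
    Q.diagAct r s h (m ⊗ₜ n) = (productMap α β).comp Q.comul h • (m ⊗ₜ n) :=
  tensorAct_eigen hm hn (Q.comul h)

theorem associator_eigen {r : H →ₐ[k] Module.End k M} {s : H →ₐ[k] Module.End k N}
    {t : H →ₐ[k] Module.End k P} {α β γ : H →ₐ[k] k} {m : M} {n : N} {p : P}
    (hm : ∀ x, r x m = α x • m) (hn : ∀ y, s y n = β y • n) (hp : ∀ z, t z p = γ z • p) :
    Q.associator r s t ((m ⊗ₜ n) ⊗ₜ p) =
      productMap α (productMap β γ) (Q.Phi : H ⊗[k] (H ⊗[k] H)) • (m ⊗ₜ (n ⊗ₜ p)) :=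
  tensorAct_eigen hm (fun z => tensorAct_eigen hn hp z) _

theorem associatorInv_eigen {r : H →ₐ[k] Module.End k M} {s : H →ₐ[k] Module.End k N}
    {t : H →ₐ[k] Module.End k P} {α β γ : H →ₐ[k] k} {m : M} {n : N} {p : P}
    (hm : ∀ x, r x m = α x • m) (hn : ∀ y, s y n = β y • n) (hp : ∀ z, t z p = γ z • p) :
    Q.associatorInv r s t (m ⊗ₜ (n ⊗ₜ p)) =
      productMap α (productMap β γ) (↑Q.Phi⁻¹ : H ⊗[k] (H ⊗[k] H)) • ((m ⊗ₜ n) ⊗ₜ p) := by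
  have h := tensorAct_eigen hm (fun z => tensorAct_eigen hn hp z)
    (↑Q.Phi⁻¹ : H ⊗[k] (H ⊗[k] H))
  simp only [associatorInv, LinearMap.comp_apply, h]
  simp

/-- Both sides are an element of `H ⊗ H` tensored with `m`, so on an eigenline the coassociativity
axiom is an equation for `v` alone. -/
theorem coassoc_eigen_iff {r : H →ₐ[k] Module.End k M} {d : M →ₗ[k] H ⊗[k] M} {α : H →ₐ[k] k}
    {m : M} {v : H} (hm : ∀ x, r x m = α x • m) (hv : d m = v ⊗ₜ m) (h0 : m ≠ 0) :
    TensorProduct.homTensorHomMap (RingHom.id k) H M H (H ⊗[k] M)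
        (TensorProduct.map (LinearMap.mul k H) (actThenMul r d)
          (Q.Phi : H ⊗[k] (H ⊗[k] H))) (d m) =
      tensorAct (Algebra.lmul k H) (tensorAct (Algebra.lmul k H) r)
        (Q.Phi : H ⊗[k] (H ⊗[k] H))
        (TensorProduct.assoc k H H M
          (actThenMul r (Q.comul.toLinearMap.rTensor M ∘ₗ d)
            (Q.Phi : H ⊗[k] (H ⊗[k] H)) m)) ↔
    (1 ⊗ₜ v) * contract2 α (Q.Phi : H ⊗[k] (H ⊗[k] H)) * (v ⊗ₜ 1) =
      contract3 α (Q.Phi : H ⊗[k] (H ⊗[k] H)) *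
        (Q.comul v * contract1 α (Q.Phi : H ⊗[k] (H ⊗[k] H))) := by
  have hw : (Q.comul.toLinearMap.rTensor M ∘ₗ d) m = Q.comul v ⊗ₜ m := by simp [hv]
  rw [coassoc_left_eigen hm hv, actThenMul_comul_eigen hm hw, coassoc_right_eigen hm,
    (TensorProduct.assoc k H H M).injective.eq_iff]
  refine ⟨fun h => ?_, fun h => by rw [h]⟩
  -- A functional that does not vanish on `m` removes the last tensor factor.
  obtain ⟨ψ, hψ⟩ := Module.Projective.exists_dual_ne_zero k h0
  have := congrArg (TensorProduct.rid k (H ⊗[k] H) ∘ ψ.lTensor (H ⊗[k] H)) h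
  simpa [hψ] using this

theorem act_coact_eigen {r : H →ₐ[k] Module.End k M} {d : M →ₗ[k] H ⊗[k] M} {α : H →ₐ[k] k}
    {m : M} {v : H} (hm : ∀ x, r x m = α x • m) (hv : d m = v ⊗ₜ m) (h : H)
    (hc : contractRight α (Q.comul h) * v = v * contractLeft α (Q.comul h)) :
    tensorAct (Algebra.lmul k H) r (Q.comul h) (d m) = actThenMul r d (Q.comul h) m := by
  rw [actThenMul_eigen hm hv, hv, tensorAct_lmul_eigen hm, hc]

theorem diagCoact_eigen {r : H →ₐ[k] Module.End k M} {d : M →ₗ[k] H ⊗[k] M}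
    {s : H →ₐ[k] Module.End k N} {e : N →ₗ[k] H ⊗[k] N} {α β : H →ₐ[k] k} {m : M} {n : N}
    {v w : H} (hm : ∀ x, r x m = α x • m) (hn : ∀ y, s y n = β y • n)
    (hv : d m = v ⊗ₜ m) (hw : e n = w ⊗ₜ n) :
    Q.diagCoact r d s e (m ⊗ₜ n) =
      (contractRight α (contract3 β (Q.Phi : H ⊗[k] (H ⊗[k] H))) *
        (v * (contractLeft α (contract3 β (↑Q.Phi⁻¹ : H ⊗[k] (H ⊗[k] H))) *
        (w * contractLeft α (contract2 β (Q.Phi : H ⊗[k] (H ⊗[k] H))))))) ⊗ₜ (m ⊗ₜ n) := by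
  -- `h1`, `h2`, `h3` evaluate the factors `Y`, `x`, `X` of the coaction formula, from the innermost
  -- outwards.
  have h1 : ∀ z : H ⊗[k] (H ⊗[k] H),
      TensorProduct.homTensorHomMap (RingHom.id k) M N M (H ⊗[k] N)
        (TensorProduct.map r.toLinearMap (actThenMul s e) z) (m ⊗ₜ n) =
      m ⊗ₜ ((w * contractLeft α (contract2 β z)) ⊗ₜ n) := by
    intro z
    induction z with
    | zero => simp
    | add x y hx hy => simp [hx, hy, mul_add, TensorProduct.add_tmul, TensorProduct.tmul_add]
    | tmul x y =>
      simp only [TensorProduct.map_tmul, TensorProduct.homTensorHomMap_apply,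
        TensorProduct.map_tmul, actThenMul_eigen hn hw, AlgHom.toLinearMap_apply, hm]
      induction y with
      | zero => simp
      | tmul y z => simp [← TensorProduct.smul_tmul', TensorProduct.tmul_smul, smul_smul, mul_comm]
      | add y z hy hz =>
        simp only [TensorProduct.tmul_add, map_add, mul_add, TensorProduct.add_tmul, hy, hz]
  have h2 : ∀ (z : H ⊗[k] (H ⊗[k] H)) (h : H),
      tensorAct r (tensorAct (Algebra.lmul k H) s) z (m ⊗ₜ (h ⊗ₜ n)) =
      m ⊗ₜ ((contractLeft α (contract3 β z) * h) ⊗ₜ n) := by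
    intro z h
    induction z with
    | zero => simp
    | add x y hx hy => simp [hx, hy, add_mul, TensorProduct.add_tmul, TensorProduct.tmul_add]
    | tmul x y =>
      rw [tensorAct_tmul_tmul, tensorAct_lmul_eigen hn, hm]
      induction y with
      | zero => simp
      | tmul y z => simp [← TensorProduct.smul_tmul', TensorProduct.tmul_smul, smul_smul, mul_comm]
      | add y z hy hz =>
        simp only [TensorProduct.tmul_add, map_add, add_mul, TensorProduct.add_tmul, hy, hz]
  have h3 : ∀ (z : H ⊗[k] (H ⊗[k] H)) (h : H),
      tensorAct (Algebra.lmul k H) (tensorAct r s) z (h ⊗ₜ (m ⊗ₜ n)) =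
      (contractRight α (contract3 β z) * h) ⊗ₜ (m ⊗ₜ n) := by
    intro z h
    induction z with
    | zero => simp
    | add x y hx hy => simp [hx, hy, add_mul, TensorProduct.add_tmul]
    | tmul x y =>
      rw [tensorAct_tmul_tmul, tensorAct_eigen hm hn]
      induction y with
      | zero => simp
      | tmul y z => simp [← TensorProduct.smul_tmul', TensorProduct.tmul_smul, smul_smul, mul_comm]
      | add y z hy hz =>
        simp only [TensorProduct.tmul_add, map_add, add_mul, add_smul, TensorProduct.add_tmul, hy,
          hz]
  simp only [diagCoact, LinearMap.comp_apply, h1, h2, LinearMap.rTensor_tmul, hv,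
    LinearEquiv.coe_coe, TensorProduct.tensorTensorTensorComm_tmul, LinearMap.mul'_apply, h3]

end QuasiBialgebra

theorem braiding_eigen {d : M →ₗ[k] H ⊗[k] M} {s : H →ₐ[k] Module.End k N} {β : H →ₐ[k] k}
    {m : M} {n : N} {v : H} (hv : d m = v ⊗ₜ m) (hn : ∀ y, s y n = β y • n) :
    braiding d s (m ⊗ₜ n) = β v • (n ⊗ₜ m) := by
  simp [braiding, hv, hn, TensorProduct.smul_tmul']

end Eigen

/-! ### Characters evaluated on contracted tensors -/

section Contract

variable {k H : Type*} [Field k] [Ring H] [Algebra k H]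

theorem productMap_contract1 (α β γ : H →ₐ[k] k) (z : H ⊗[k] (H ⊗[k] H)) :
    productMap α β (contract1 γ z) = productMap γ (productMap α β) z := by
  refine DFunLike.congr_fun (f := (productMap α β).comp (contract1 γ)) ?_ z
  exact Algebra.TensorProduct.ext' fun x y => by simp

theorem productMap_contract2 (α β γ : H →ₐ[k] k) (z : H ⊗[k] (H ⊗[k] H)) :
    productMap α β (contract2 γ z) = productMap α (productMap γ β) z := by
  induction z with
  | zero => simp
  | add x y hx hy => simp only [map_add, hx, hy]
  | tmul x y =>
    induction y with
    | zero => simp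
    | add y z hy hz => simp only [TensorProduct.tmul_add, map_add, hy, hz]
    | tmul y z => simp [mul_left_comm]

theorem productMap_contract3 (α β γ : H →ₐ[k] k) (z : H ⊗[k] (H ⊗[k] H)) :
    productMap α β (contract3 γ z) = productMap α (productMap β γ) z := by
  induction z with
  | zero => simp
  | add x y hx hy => simp only [map_add, hx, hy]
  | tmul x y =>
    induction y with
    | zero => simp
    | add y z hy hz => simp only [TensorProduct.tmul_add, map_add, hy, hz]
    | tmul y z => simp only [contract3_tmul, map_smul, Algebra.TensorProduct.productMap_apply_tmul,
        smul_eq_mul]; ring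

theorem apply_contractLeft (α β : H →ₐ[k] k) (z : H ⊗[k] H) :
    α (contractLeft β z) = productMap β α z := by
  induction z with
  | zero => simp
  | add x y hx hy => simp only [map_add, hx, hy]
  | tmul x y => simp

theorem apply_contractRight (α β : H →ₐ[k] k) (z : H ⊗[k] H) :
    α (contractRight β z) = productMap α β z := by
  induction z with
  | zero => simp
  | add x y hx hy => simp only [map_add, hx, hy]
  | tmul x y => simp [mul_comm]

end Contract

/-! ### Characters of the cyclic group and homogeneous elements -/

section CyclicEigen

variable {k G : Type*} [Field k] [CommGroup G]
variable {m : ℕ} {q : k} {g : G} (hg : ∀ x, x ∈ Subgroup.zpowers g) (hG : Nat.card G = m)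
    (hq : IsPrimitiveRoot q m) (hm : 2 ≤ m)

/-- The value of `Φ_c` at the triple of characters with indices `a`, `b`, `d`. -/
def cocycle (m : ℕ) (q : k) (c a b d : ℕ) : k := q ^ (c * (a % m) * ((b % m + d % m) / m))

@[simp] theorem cocycle_zero_left (c b d : ℕ) : cocycle m q c 0 b d = 1 := by
  simp [cocycle]

theorem cocycle_zero_mid (hm : 2 ≤ m) (c a d : ℕ) : cocycle m q c a 0 d = 1 := by
  simp [cocycle, Nat.div_eq_of_lt (Nat.mod_lt d (by omega : m > 0))]

theorem cocycle_zero_right (hm : 2 ≤ m) (c a b : ℕ) : cocycle m q c a b 0 = 1 := by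
  simp [cocycle, Nat.div_eq_of_lt (Nat.mod_lt b (by omega : m > 0))]

/-- The carry `⌊(b + d)/m⌋` is symmetric. This makes two of the three cocycle factors in the
coassociativity of a coaction cancel. -/
theorem cocycle_swap (c a b d : ℕ) : cocycle m q c a b d = cocycle m q c a d b := by
  simp only [cocycle, add_comm]

theorem cocycle_ne_zero (hq : IsPrimitiveRoot q m) (hm : 2 ≤ m) (c a b d : ℕ) :
    cocycle m q c a b d ≠ 0 :=
  pow_ne_zero _ (hq.ne_zero (by omega))

theorem eval_Phi (c a b d : ℕ) :
    productMap (chi hg hG hq hm a) (productMap (chi hg hG hq hm b) (chi hg hG hq hm d))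
      ((cyclicQuasiBialgebra hg hG hq hm c).Phi :
        MonoidAlgebra k G ⊗[k] (MonoidAlgebra k G ⊗[k] MonoidAlgebra k G)) =
      cocycle m q c a b d :=
  eval_reassociator hg hG hq hm q c a b d

theorem eval_Phi_inv (c a b d : ℕ) :
    productMap (chi hg hG hq hm a) (productMap (chi hg hG hq hm b) (chi hg hG hq hm d))
      ((↑(cyclicQuasiBialgebra hg hG hq hm c).Phi⁻¹ :
        MonoidAlgebra k G ⊗[k] (MonoidAlgebra k G ⊗[k] MonoidAlgebra k G))) =
      (cocycle m q c a b d)⁻¹ := by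
  refine (eval_reassociator hg hG hq hm q⁻¹ c a b d).trans ?_
  rw [cocycle, inv_pow]

theorem chi_comul_apply (c a b : ℕ) (x : MonoidAlgebra k G) :
    productMap (chi hg hG hq hm a) (chi hg hG hq hm b)
      ((cyclicQuasiBialgebra hg hG hq hm c).comul x) = chi hg hG hq hm (a + b) x :=
  DFunLike.congr_fun (chi_comul hg hG hq hm a b) x

theorem counit_eq_chi (c : ℕ) (x : MonoidAlgebra k G) :
    (cyclicQuasiBialgebra hg hG hq hm c).counit x = chi hg hG hq hm 0 x :=
  DFunLike.congr_fun (chi_zero hg hG hq hm) x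

theorem sep_H2 {x y : MonoidAlgebra k G ⊗[k] MonoidAlgebra k G}
    (h : ∀ a < m, ∀ b < m, productMap (chi hg hG hq hm a) (chi hg hG hq hm b) x =
      productMap (chi hg hG hq hm a) (chi hg hG hq hm b) y) : x = y :=
  sep_tensor hg hG hq hm (fun i : Fin m => chi hg hG hq hm i)
    (fun _ _ h => sep_H hg hG hq hm fun a ha => h ⟨a, ha⟩) fun a ha b => h a ha b b.2

/-- `v(a) v(b) Φ(a, f, b) = v(a + b) Φ(a, b, f) Φ(f, a, b)` after cancelling
`Φ(a, f, b) = Φ(a, b, f)`: the condition for `n ↦ v ⊗ n` to be a coaction on a line on which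
`g` acts by `q ^ f`. -/
def IsTwistedCharacter (c f : ℕ) (v : MonoidAlgebra k G) : Prop :=
  ∀ a < m, ∀ b < m, chi hg hG hq hm a v * chi hg hG hq hm b v =
    chi hg hG hq hm (a + b) v * cocycle m q c f a b

/-- Under `χ_a ⊗ χ_b` the three contractions become `Φ(a,f,b)`, `Φ(a,b,f)` and `Φ(f,a,b)`. The first
two are equal and nonzero, so they cancel. -/
theorem twistedCharacter_iff (c f : ℕ) (v : MonoidAlgebra k G) :
    (1 ⊗ₜ v) * contract2 (chi hg hG hq hm f) (cyclicQuasiBialgebra hg hG hq hm c).Phi.val *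
        (v ⊗ₜ 1) =
      contract3 (chi hg hG hq hm f) (cyclicQuasiBialgebra hg hG hq hm c).Phi.val *
        ((cyclicQuasiBialgebra hg hG hq hm c).comul v *
          contract1 (chi hg hG hq hm f) (cyclicQuasiBialgebra hg hG hq hm c).Phi.val) ↔
    IsTwistedCharacter hg hG hq hm c f v := by
  have key : ∀ a b,
      (productMap (chi hg hG hq hm a) (chi hg hG hq hm b) ((1 ⊗ₜ v) *
          contract2 (chi hg hG hq hm f) (cyclicQuasiBialgebra hg hG hq hm c).Phi.val *
          (v ⊗ₜ 1)) =
        productMap (chi hg hG hq hm a) (chi hg hG hq hm b)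
          (contract3 (chi hg hG hq hm f) (cyclicQuasiBialgebra hg hG hq hm c).Phi.val *
          ((cyclicQuasiBialgebra hg hG hq hm c).comul v *
            contract1 (chi hg hG hq hm f) (cyclicQuasiBialgebra hg hG hq hm c).Phi.val))) ↔
      chi hg hG hq hm a v * chi hg hG hq hm b v =
        chi hg hG hq hm (a + b) v * cocycle m q c f a b := by
    intro a b
    rw [map_mul, map_mul, map_mul, map_mul, productMap_contract1, productMap_contract2,
      productMap_contract3, eval_Phi, eval_Phi, eval_Phi, chi_comul_apply,
      Algebra.TensorProduct.productMap_apply_tmul, Algebra.TensorProduct.productMap_apply_tmul,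
      cocycle_swap c a b f, map_one, map_one, one_mul, mul_one]
    constructor
    · intro h
      exact mul_left_cancel₀ (cocycle_ne_zero hq hm c a f b) (by linear_combination h)
    · intro h
      linear_combination cocycle m q c a f b * h
  constructor
  · intro h a _ b _
    exact (key a b).mp (by rw [h])
  · intro h
    exact sep_H2 hg hG hq hm fun a ha b hb => (key a b).mpr (h a ha b hb)

/-- Holds for every `v`, because `k[G]` is commutative and cocommutative. The compatibility of
action and coaction thus imposes nothing on `v`. -/
theorem contract_comul_comm (c f : ℕ) (v h : MonoidAlgebra k G) :
    contractRight (chi hg hG hq hm f) ((cyclicQuasiBialgebra hg hG hq hm c).comul h) * v =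
      v * contractLeft (chi hg hG hq hm f) ((cyclicQuasiBialgebra hg hG hq hm c).comul h) := by
  refine sep_H hg hG hq hm fun a _ => ?_
  rw [map_mul, map_mul, apply_contractLeft, apply_contractRight, chi_comul_apply,
    chi_comul_apply, add_comm, mul_comm]

variable {B : Type*} [AddCommGroup B] [Module k B]

/-- `b` spans a line on which `g` acts by `q ^ f` and which coacts by `v`. -/
structure IsHomogeneous (D : BraidedHopfData k (MonoidAlgebra k G) B) (f : ℕ)
    (v : MonoidAlgebra k G) (b : B) : Prop where
  act : ∀ h, D.act h b = chi hg hG hq hm f h • b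
  coact : D.coact b = v ⊗ₜ b

variable {hg hG hq hm}
variable {D : BraidedHopfData k (MonoidAlgebra k G) B} {f₁ f₂ f₃ f₄ : ℕ}
  {v₁ v₂ v₃ v₄ : MonoidAlgebra k G} {b₁ b₂ b₃ b₄ : B}

theorem IsHomogeneous.diagAct (c : ℕ) (h₁ : IsHomogeneous hg hG hq hm D f₁ v₁ b₁)
    (h₂ : IsHomogeneous hg hG hq hm D f₂ v₂ b₂) (h : MonoidAlgebra k G) :
    (cyclicQuasiBialgebra hg hG hq hm c).diagAct D.act D.act h (b₁ ⊗ₜ b₂) =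
      chi hg hG hq hm (f₁ + f₂) h • (b₁ ⊗ₜ b₂) := by
  rw [QuasiBialgebra.diagAct_eigen _ h₁.act h₂.act, AlgHom.comp_apply, chi_comul_apply]

theorem IsHomogeneous.associator (c : ℕ) (h₁ : IsHomogeneous hg hG hq hm D f₁ v₁ b₁)
    (h₂ : IsHomogeneous hg hG hq hm D f₂ v₂ b₂) (h₃ : IsHomogeneous hg hG hq hm D f₃ v₃ b₃) :
    (cyclicQuasiBialgebra hg hG hq hm c).associator D.act D.act D.act ((b₁ ⊗ₜ b₂) ⊗ₜ b₃) =
      cocycle m q c f₁ f₂ f₃ • (b₁ ⊗ₜ (b₂ ⊗ₜ b₃)) := by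
  rw [QuasiBialgebra.associator_eigen _ h₁.act h₂.act h₃.act, eval_Phi]

/-- Each of the four associativity constraints in the definition contributes a value of `Φ` or its
inverse, and braiding `b₂` past `b₃` contributes `χ_{f₃}(v₂)`. Indices such as `f₃ + f₄` occur where
a product `B ⊗ B` is treated as one module. -/
theorem IsHomogeneous.tensorMul (c : ℕ) (h₁ : IsHomogeneous hg hG hq hm D f₁ v₁ b₁)
    (h₂ : IsHomogeneous hg hG hq hm D f₂ v₂ b₂) (h₃ : IsHomogeneous hg hG hq hm D f₃ v₃ b₃)
    (h₄ : IsHomogeneous hg hG hq hm D f₄ v₄ b₄) :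
    YD.tensorMul (cyclicQuasiBialgebra hg hG hq hm c) D ((b₁ ⊗ₜ b₂) ⊗ₜ (b₃ ⊗ₜ b₄)) =
      (cocycle m q c f₁ f₂ (f₃ + f₄) * (cocycle m q c f₂ f₃ f₄)⁻¹ * chi hg hG hq hm f₃ v₂ *
        cocycle m q c f₃ f₂ f₄ * (cocycle m q c f₁ f₃ (f₂ + f₄))⁻¹) •
        (D.mul (b₁ ⊗ₜ b₃) ⊗ₜ D.mul (b₂ ⊗ₜ b₄)) := by
  simp only [YD.tensorMul, LinearMap.comp_apply,
    QuasiBialgebra.associator_eigen _ h₁.act h₂.act (h₃.diagAct c h₄), eval_Phi, map_smul,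
    LinearMap.lTensor_tmul, LinearMap.rTensor_tmul,
    QuasiBialgebra.associatorInv_eigen _ h₂.act h₃.act h₄.act, eval_Phi_inv,
    TensorProduct.tmul_smul, braiding_eigen h₂.coact h₃.act, ← TensorProduct.smul_tmul',
    QuasiBialgebra.associator_eigen _ h₃.act h₂.act h₄.act,
    QuasiBialgebra.associatorInv_eigen _ h₁.act h₃.act (h₂.diagAct c h₄), smul_smul,
    TensorProduct.map_tmul]

/-- The values of `Φ` involved are at `(a,f₁,f₂)`, `(f₁,a,f₂)` and `(f₁,f₂,a)`; normalization makes
all three trivial once `f₁` or `f₂` is zero. -/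
theorem IsHomogeneous.diagCoact (c : ℕ) (h₁ : IsHomogeneous hg hG hq hm D f₁ v₁ b₁)
    (h₂ : IsHomogeneous hg hG hq hm D f₂ v₂ b₂) (h0 : f₁ = 0 ∨ f₂ = 0) :
    (cyclicQuasiBialgebra hg hG hq hm c).diagCoact D.act D.coact D.act D.coact (b₁ ⊗ₜ b₂) =
      (v₁ * v₂) ⊗ₜ (b₁ ⊗ₜ b₂) := by
  rw [QuasiBialgebra.diagCoact_eigen _ h₁.act h₂.act h₁.coact h₂.coact]
  congr 1
  refine sep_H hg hG hq hm fun a _ => ?_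
  rw [map_mul, map_mul, map_mul, map_mul, map_mul, apply_contractRight, apply_contractLeft,
    apply_contractLeft, productMap_contract3, productMap_contract3, productMap_contract2, eval_Phi,
    eval_Phi, eval_Phi_inv]
  rcases h0 with rfl | rfl <;> simp [cocycle_zero_mid hm, cocycle_zero_right hm]

end CyclicEigen

/-! ### Linear maps out of the dual numbers -/

section DualNumbers

open DualNumber

variable {k M : Type*} [Field k] [AddCommGroup M] [Module k M]

theorem dualNumber_eq (x : DualNumber k) :
    x = x.fst • (1 : DualNumber k) + x.snd • (eps : DualNumber k) := by
  ext <;> simp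

theorem dualNumber_hom_ext {φ ψ : DualNumber k →ₗ[k] M} (h1 : φ 1 = ψ 1) (hn : φ eps = ψ eps) :
    φ = ψ := by
  refine LinearMap.ext fun x => ?_
  rw [dualNumber_eq x, map_add, map_add, map_smul, map_smul, map_smul, map_smul, h1, hn]

theorem dualNumber_tmul_hom_ext {φ ψ : DualNumber k ⊗[k] DualNumber k →ₗ[k] M}
    (h11 : φ (1 ⊗ₜ 1) = ψ (1 ⊗ₜ 1)) (h1n : φ (1 ⊗ₜ eps) = ψ (1 ⊗ₜ eps))
    (hn1 : φ (eps ⊗ₜ 1) = ψ (eps ⊗ₜ 1)) (hnn : φ (eps ⊗ₜ eps) = ψ (eps ⊗ₜ eps)) : φ = ψ :=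
  TensorProduct.ext <| dualNumber_hom_ext (dualNumber_hom_ext h11 h1n)
    (dualNumber_hom_ext hn1 hnn)

theorem dualNumber_tmul_tmul_hom_ext
    {φ ψ : (DualNumber k ⊗[k] DualNumber k) ⊗[k] DualNumber k →ₗ[k] M}
    (h1 : ∀ x ∈ ({1, eps} : Set (DualNumber k)), ∀ y ∈ ({1, eps} : Set (DualNumber k)),
      ∀ z ∈ ({1, eps} : Set (DualNumber k)), φ ((x ⊗ₜ y) ⊗ₜ z) = ψ ((x ⊗ₜ y) ⊗ₜ z)) : φ = ψ := by
  refine TensorProduct.ext <| dualNumber_tmul_hom_ext ?_ ?_ ?_ ?_ <;>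
    refine dualNumber_hom_ext (h1 _ ?_ _ ?_ _ ?_) (h1 _ ?_ _ ?_ _ ?_) <;> simp

end DualNumbers

/-! ### The structure maps of `B_{σ,v}` on `1` and `n` -/

section BsvLemmas

open DualNumber

variable {k H : Type*} [Field k] [Ring H] [Algebra k H] (Q : QuasiBialgebra k H) (σ : H →ₐ[k] k)
  (v : H)

@[simp] theorem Bsv_act_one (h : H) : (Bsv Q σ v).act h 1 = Q.counit h • 1 := by simp [Bsv]
@[simp] theorem Bsv_act_eps (h : H) : (Bsv Q σ v).act h eps = σ h • eps := by simp [Bsv]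
@[simp] theorem Bsv_coact_one : (Bsv Q σ v).coact 1 = 1 ⊗ₜ 1 := by
  change (1 : DualNumber k).fst • ((1 : H) ⊗ₜ[k] (1 : DualNumber k)) +
    (1 : DualNumber k).snd • (v ⊗ₜ[k] (eps : DualNumber k)) = _
  simp
@[simp] theorem Bsv_coact_eps : (Bsv Q σ v).coact eps = v ⊗ₜ eps := by
  change (eps : DualNumber k).fst • ((1 : H) ⊗ₜ[k] (1 : DualNumber k)) +
    (eps : DualNumber k).snd • (v ⊗ₜ[k] (eps : DualNumber k)) = _
  simp
@[simp] theorem Bsv_mul (x y : DualNumber k) : (Bsv Q σ v).mul (x ⊗ₜ y) = x * y := by simp [Bsv]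
@[simp] theorem Bsv_one : (Bsv Q σ v).one = 1 := rfl
@[simp] theorem Bsv_comul_one : (Bsv Q σ v).comul 1 = 1 ⊗ₜ 1 := by simp [Bsv]
@[simp] theorem Bsv_comul_eps : (Bsv Q σ v).comul eps = eps ⊗ₜ 1 + 1 ⊗ₜ eps := by simp [Bsv]
@[simp] theorem Bsv_counit_one : (Bsv Q σ v).counit 1 = 1 := rfl
@[simp] theorem Bsv_counit_eps : (Bsv Q σ v).counit eps = 0 := rfl
@[simp] theorem Bsv_antipode_one : (Bsv Q σ v).antipode 1 = 1 := by simp [Bsv]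
@[simp] theorem Bsv_antipode_eps : (Bsv Q σ v).antipode eps = -eps := by simp [Bsv]

end BsvLemmas

/-! ### `B_{σ,v}` over `k_{Φ_c}[G]` -/

section CyclicBsv

open DualNumber

variable {k G : Type*} [Field k] [CommGroup G]
variable {m : ℕ} {q : k} {g : G} {hg : ∀ x, x ∈ Subgroup.zpowers g} {hG : Nat.card G = m}
    {hq : IsPrimitiveRoot q m} {hm : 2 ≤ m} {c f : ℕ} {v : MonoidAlgebra k G}

theorem Bsv_one_homogeneous : IsHomogeneous hg hG hq hm
    (Bsv (cyclicQuasiBialgebra hg hG hq hm c) (chi hg hG hq hm f) v) 0 1 1 :=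
  ⟨fun h => by rw [Bsv_act_one, counit_eq_chi], Bsv_coact_one _ _ _⟩

theorem Bsv_eps_homogeneous : IsHomogeneous hg hG hq hm
    (Bsv (cyclicQuasiBialgebra hg hG hq hm c) (chi hg hG hq hm f) v) f v eps :=
  ⟨fun h => Bsv_act_eps _ _ _ h, Bsv_coact_eps _ _ _⟩

theorem isTwistedCharacter_one : IsTwistedCharacter hg hG hq hm c 0 1 := by
  intro a _ b _; simp

theorem Bsv_isYDModule (hv : IsTwistedCharacter hg hG hq hm c f v)
    (hv0 : chi hg hG hq hm 0 v = 1) :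
    (cyclicQuasiBialgebra hg hG hq hm c).IsYDModule
      (Bsv (cyclicQuasiBialgebra hg hG hq hm c) (chi hg hG hq hm f) v).act
      (Bsv (cyclicQuasiBialgebra hg hG hq hm c) (chi hg hG hq hm f) v).coact := by
  have H1 := Bsv_one_homogeneous (hg := hg) (hG := hG) (hq := hq) (hm := hm) (c := c) (f := f)
    (v := v)
  have Hn := Bsv_eps_homogeneous (hg := hg) (hG := hG) (hq := hq) (hm := hm) (c := c) (f := f)
    (v := v)
  refine ⟨fun x => ?_, fun x => ?_, fun h x => ?_⟩
  · rw [dualNumber_eq x]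
    simp [counit_eq_chi, hv0]
  · have h1 := (QuasiBialgebra.coassoc_eigen_iff _ H1.act H1.coact one_ne_zero).mpr
      ((twistedCharacter_iff hg hG hq hm c 0 1).mpr isTwistedCharacter_one)
    have hn := (QuasiBialgebra.coassoc_eigen_iff _ Hn.act Hn.coact
      (fun h => by simpa using congrArg TrivSqZeroExt.snd h)).mpr
      ((twistedCharacter_iff hg hG hq hm c f v).mpr hv)
    rw [dualNumber_eq x]
    simp only [map_add, map_smul, h1, hn]
  · have h1 := QuasiBialgebra.act_coact_eigen _ H1.act H1.coact h
      (contract_comul_comm hg hG hq hm c 0 1 h)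
    have hn := QuasiBialgebra.act_coact_eigen _ Hn.act Hn.coact h
      (contract_comul_comm hg hG hq hm c f v h)
    rw [dualNumber_eq x]
    simp only [map_add, map_smul, h1, hn]

/-- Every axiom is checked on the basis `1`, `n`. Associators involving a factor `1` are trivial,
and on `n ⊗ n ⊗ n` all products vanish. The value `χ_f(v) = -1` is needed only for the
multiplicativity of `Δ` on `n ⊗ n`. -/
theorem Bsv_isBraidedHopfAlgebra (hv : IsTwistedCharacter hg hG hq hm c f v)
    (hv0 : chi hg hG hq hm 0 v = 1) (hvf : chi hg hG hq hm f v = -1) :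
    IsBraidedHopfAlgebra (cyclicQuasiBialgebra hg hG hq hm c)
      (Bsv (cyclicQuasiBialgebra hg hG hq hm c) (chi hg hG hq hm f) v) := by
  have H1 := Bsv_one_homogeneous (hg := hg) (hG := hG) (hq := hq) (hm := hm) (c := c) (f := f)
    (v := v)
  have Hn := Bsv_eps_homogeneous (hg := hg) (hG := hG) (hq := hq) (hm := hm) (c := c) (f := f)
    (v := v)
  have cm := fun a d => cocycle_zero_mid (q := q) hm c a d
  have cr := fun a b => cocycle_zero_right (q := q) hm c a b
  refine
    { isYDModule := Bsv_isYDModule hv hv0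
      one_mul := fun b => by simp
      mul_one := fun b => by simp
      mul_assoc := ?_
      act_mul := fun h => ?_
      act_one := fun h => by simp
      coact_mul := ?_
      coact_one := by simp
      counit_comul := fun x => by rw [dualNumber_eq x]; simp
      comul_counit := fun x => by rw [dualNumber_eq x]; simp
      comul_coassoc := ?_
      comul_act := fun h => ?_
      counit_act := fun h x => by rw [dualNumber_eq x]; simp [mul_comm]
      coact_comul := ?_
      coact_counit := fun x => by rw [dualNumber_eq x]; simp
      comul_one := by simp
      counit_one := by simp
      counit_mul := fun x y => by rw [Bsv_mul]; exact TrivSqZeroExt.fst_mul x y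
      comul_mul := ?_
      antipode_act := fun h => dualNumber_hom_ext (by simp) (by simp)
      coact_antipode := dualNumber_hom_ext (by simp) (by simp [TensorProduct.tmul_neg])
      antipode_left := fun x => by rw [dualNumber_eq x]; simp
      antipode_right := fun x => by rw [dualNumber_eq x]; simp }
  · refine dualNumber_tmul_tmul_hom_ext ?_
    rintro x (rfl | rfl) y (rfl | rfl) z (rfl | rfl) <;>
      simp [H1.associator c H1 H1, H1.associator c H1 Hn, H1.associator c Hn H1,
        H1.associator c Hn Hn, Hn.associator c H1 H1, Hn.associator c H1 Hn,
        Hn.associator c Hn H1, Hn.associator c Hn Hn, cm, cr]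
  · refine dualNumber_tmul_hom_ext ?_ ?_ ?_ ?_ <;>
      simp [H1.diagAct c H1, H1.diagAct c Hn, Hn.diagAct c H1, Hn.diagAct c Hn, counit_eq_chi]
  · refine dualNumber_tmul_hom_ext ?_ ?_ ?_ ?_
    · simp [H1.diagCoact c H1 (Or.inl rfl)]
    · simp [H1.diagCoact c Hn (Or.inl rfl)]
    · simp [Hn.diagCoact c H1 (Or.inr rfl)]
    -- The cocycle factors need not be trivial on `n ⊗ n`, but both sides vanish because `n² = 0`.
    · simp [QuasiBialgebra.diagCoact_eigen _ Hn.act Hn.act Hn.coact Hn.coact]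
  · refine dualNumber_hom_ext ?_ ?_ <;>
      simp [TensorProduct.add_tmul, TensorProduct.tmul_add, H1.associator c H1 H1,
        H1.associator c H1 Hn, H1.associator c Hn H1, Hn.associator c H1 H1, cm, cr, add_assoc]
  · refine dualNumber_hom_ext ?_ ?_ <;>
      simp [H1.diagAct c H1, H1.diagAct c Hn, Hn.diagAct c H1, counit_eq_chi]
  · refine dualNumber_hom_ext ?_ ?_ <;>
      simp [H1.diagCoact c H1 (Or.inl rfl), H1.diagCoact c Hn (Or.inl rfl),
        Hn.diagCoact c H1 (Or.inr rfl), TensorProduct.tmul_add]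
  · refine dualNumber_tmul_hom_ext ?_ ?_ ?_ ?_ <;>
      simp [TensorProduct.tmul_add, TensorProduct.add_tmul, H1.tensorMul c H1 H1 H1,
        H1.tensorMul c H1 H1 Hn, H1.tensorMul c H1 Hn H1, H1.tensorMul c Hn H1 H1,
        Hn.tensorMul c H1 H1 H1, Hn.tensorMul c H1 H1 Hn, Hn.tensorMul c H1 Hn H1,
        H1.tensorMul c Hn H1 Hn, H1.tensorMul c Hn Hn H1, cm, cr, hv0, hvf]
    -- The two mixed terms of `Δ(n)Δ(n)` are both multiples of `n ⊗ n`, with coefficients `1` and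
    -- `χ_f(v) = -1`.
    have h (z : DualNumber k ⊗[k] DualNumber k) : (-1 : k) • z + z = 0 := by
      nth_rw 2 [← one_smul k z]
      rw [← add_smul, neg_add_cancel, zero_smul]
    exact (h _).symm

theorem finrank_dualNumber : Module.finrank k (DualNumber k) = 2 := by
  have : Module.finrank k (k × k) = 2 := by simp
  exact this

/-- The `H`-module structure already distinguishes the two: `v` acts on `n` by `-1`, and on a
trivial module by `ε(v) = 1`. -/
theorem Bsv_not_isomorphic_trivialC2 (h2 : (2 : k) ≠ 0) (hv0 : chi hg hG hq hm 0 v = 1)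
    (hvf : chi hg hG hq hm f v = -1) :
    ¬ (Bsv (cyclicQuasiBialgebra hg hG hq hm c) (chi hg hG hq hm f) v).Isomorphic
      (trivialC2 (cyclicQuasiBialgebra hg hG hq hm c)) := by
  rintro ⟨φ, hact, -⟩
  have h := hact v eps
  rw [Bsv_act_eps, map_smul, hvf] at h
  have h' : (trivialC2 (cyclicQuasiBialgebra hg hG hq hm c)).act v (φ eps) = φ eps := by
    simp [trivialC2, counit_eq_chi, hv0, Algebra.ofId_apply]
  rw [h', neg_smul, one_smul, neg_eq_iff_add_eq_zero, ← two_smul k, smul_eq_zero] at h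
  rcases h with h | h
  · exact h2 h
  · have := (map_eq_zero_iff φ φ.injective).mp h
    simpa using congrArg TrivSqZeroExt.snd this

theorem Bsv_isNontrivialTwoDim (h2 : (2 : k) ≠ 0) (hv : IsTwistedCharacter hg hG hq hm c f v)
    (hv0 : chi hg hG hq hm 0 v = 1) (hvf : chi hg hG hq hm f v = -1) :
    IsNontrivialTwoDim (cyclicQuasiBialgebra hg hG hq hm c)
      (Bsv (cyclicQuasiBialgebra hg hG hq hm c) (chi hg hG hq hm f) v) :=
  ⟨Bsv_isBraidedHopfAlgebra hv hv0 hvf, finrank_dualNumber,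
    Bsv_not_isomorphic_trivialC2 h2 hv0 hvf⟩

/-- The condition on `Δ(v)` is the coassociativity equation solved for `Δ(v)`: the outer
contractions of `Φ` are moved across as contractions of `Φ⁻¹`. -/
theorem isAdmissiblePair_chi (hv : IsTwistedCharacter hg hG hq hm c f v)
    (hv0 : chi hg hG hq hm 0 v = 1) (hvf : chi hg hG hq hm f v = -1) :
    IsAdmissiblePair (cyclicQuasiBialgebra hg hG hq hm c) (chi hg hG hq hm f) v := by
  refine ⟨hvf, by rw [counit_eq_chi, hv0], ?_, fun h => contract_comul_comm hg hG hq hm c f v h⟩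
  have e3 : ∀ z : MonoidAlgebra k G ⊗[k] (MonoidAlgebra k G ⊗[k] MonoidAlgebra k G),
      TensorProduct.rid k _ (TensorProduct.map LinearMap.id (chi hg hG hq hm f).toLinearMap
        ((TensorProduct.assoc k _ _ _).symm z)) = contract3 (chi hg hG hq hm f) z := by
    intro z
    induction z with
    | zero => simp
    | add x y hx hy => simp only [map_add, hx, hy]
    | tmul x y =>
      induction y with
      | zero => simp
      | add y z hy hz => simp only [TensorProduct.tmul_add, map_add, hy, hz]
      | tmul y z => simp
  have h := (twistedCharacter_iff hg hG hq hm c f v).mpr hv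
  rw [e3]
  change _ = _ * ((1 ⊗ₜ v) * contract2 (chi hg hG hq hm f) _ * (v ⊗ₜ 1)) *
    contract1 (chi hg hG hq hm f) _
  rw [h, ← mul_assoc, ← mul_assoc, ← map_mul, Units.inv_mul, map_one, one_mul, mul_assoc,
    ← map_mul, Units.mul_inv, map_one, mul_one]

end CyclicBsv

/-! ### The arithmetic of `(*)` -/

section Arithmetic

variable {m c f lam : ℕ}

theorem cyclicCond_iff (hm : 2 ≤ m) :
    CyclicCond m c f lam ↔
      ∃ z : ℤ, 2 * ((m * lam + c * f) * f : ℤ) = (m : ℤ) ^ 2 * (2 * z + 1) := by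
  have h0 : (m : ℚ) ≠ 0 := by positivity
  refine exists_congr fun z => ?_
  rw [← @Int.cast_inj ℚ]
  push_cast
  constructor
  · intro h
    field_simp at h
    linear_combination h
  · intro h
    field_simp
    linear_combination h

/-- With denominators cleared, `(*)` forces `m = 2n`. Multiplying by `c` and completing the square
shows that `n` divides `cf`, and the quotient `x` satisfies `x² + 2λx = 2c(2z + 1)`. So `x` is even,
hence `c` is even and `2n` divides `cf`. This last divisibility makes the coefficient of `1_m` in
`cyclicV` equal to `1`. -/
theorem even_and_dvd_of_cyclicCond (hm : 2 ≤ m) (h : CyclicCond m c f lam) :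
    Even (Nat.gcd c m) ∧ m ∣ c * f := by
  obtain ⟨z, hz⟩ := (cyclicCond_iff hm).mp h
  have hme : (2 : ℤ) ∣ m := by
    have h1 : (2 : ℤ) ∣ (m : ℤ) ^ 2 * (2 * z + 1) := ⟨_, hz.symm⟩
    rcases Int.prime_two.dvd_or_dvd h1 with h1 | h1
    · exact Int.prime_two.dvd_of_dvd_pow h1
    · omega
  obtain ⟨n, hn⟩ := hme
  have hn0 : n ≠ 0 := by omega
  rw [hn] at hz
  have hsq : (c * f + n * lam : ℤ) ^ 2 = n ^ 2 * (lam ^ 2 + 2 * c * (2 * z + 1)) := by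
    linear_combination (c : ℤ) * (by linarith :
      ((2 * n * lam + c * f) * f : ℤ) = n ^ 2 * 2 * (2 * z + 1))
  have hdvd : n ∣ (c * f : ℤ) := by
    have h1 : n ∣ (c * f + n * lam : ℤ) := (Int.pow_dvd_pow_iff two_ne_zero).mp ⟨_, hsq⟩
    simpa using (dvd_add_left (Dvd.intro _ rfl)).mp h1
  obtain ⟨x, hx⟩ := hdvd
  have hx2 : x ^ 2 + 2 * lam * x = 2 * c * (2 * z + 1) := by
    refine mul_left_cancel₀ (pow_ne_zero 2 hn0) ?_
    rw [hx] at hsq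
    linear_combination hsq
  have hxe : (2 : ℤ) ∣ x := by
    refine Int.prime_two.dvd_of_dvd_pow (n := 2) ⟨c * (2 * z + 1) - lam * x, ?_⟩
    linear_combination hx2
  obtain ⟨y, rfl⟩ := hxe
  have hce : (2 : ℤ) ∣ c := by
    refine ⟨y ^ 2 + lam * y - c * z, ?_⟩
    linarith
  refine ⟨?_, ?_⟩
  · rw [even_iff_two_dvd]
    exact Nat.dvd_gcd (by exact_mod_cast hce) (Int.natCast_dvd_natCast.mp ⟨n, by exact_mod_cast hn⟩)
  · have : (m : ℤ) ∣ c * f := ⟨y, by rw [hx, hn]; ring⟩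
    exact_mod_cast this

theorem exists_cyclicCond (hm : 2 ≤ m) (h : Even (Nat.gcd c m)) :
    ∃ f < m, ∃ lam < m, CyclicCond m c f lam := by
  obtain ⟨d, hd⟩ := (even_iff_two_dvd.mp h).trans (Nat.gcd_dvd_left c m)
  obtain ⟨n, rfl⟩ := (even_iff_two_dvd.mp h).trans (Nat.gcd_dvd_right c m)
  subst hd
  -- With `c = 2d`, `m = 2n` and `f = n`, the condition reduces to `λ + d` being odd.
  refine ⟨n, by omega, (d + 1) % 2, by omega, (cyclicCond_iff hm).mpr ?_⟩
  obtain ⟨z, hz⟩ : ∃ z : ℕ, (d + 1) % 2 + d = 2 * z + 1 := ⟨((d + 1) % 2 + d) / 2, by omega⟩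
  refine ⟨z, ?_⟩
  have hz' : (((d + 1) % 2 : ℕ) : ℤ) + d = 2 * z + 1 := by exact_mod_cast hz
  rw [← hz']
  push_cast
  ring

/-- As `𝔮` has order `m²`, the power is `-1` exactly when the exponent is an odd multiple of `m²/2`.
Characteristic different from `2` separates `-1` from `1`. -/
theorem cyclicCond_iff_pow {k : Type*} [Field k] (h2 : (2 : k) ≠ 0) {𝔮 : k} (hm : 2 ≤ m)
    (h𝔮 : IsPrimitiveRoot 𝔮 (m ^ 2)) :
    CyclicCond m c f lam ↔ 𝔮 ^ ((m * lam + c * f) * f) = -1 := by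
  have hm0 : (m : ℤ) ^ 2 ≠ 0 := by positivity
  rw [cyclicCond_iff hm]
  generalize hE : (m * lam + c * f) * f = E
  have hE' : ((m * lam + c * f) * f : ℤ) = E := by rw [← hE]; push_cast; rfl
  rw [hE']
  constructor
  · rintro ⟨z, hz⟩
    have h1 : (𝔮 ^ E) ^ 2 = 1 := by
      rw [← pow_mul, h𝔮.pow_eq_one_iff_dvd]
      have : (m : ℤ) ^ 2 ∣ E * 2 := ⟨2 * z + 1, by linarith⟩
      exact_mod_cast this
    refine (sq_eq_one_iff.mp h1).resolve_left ?_
    rw [h𝔮.pow_eq_one_iff_dvd]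
    rintro ⟨w, hw⟩
    rw [hw] at hz
    push_cast at hz
    have : 2 * (w : ℤ) = 2 * z + 1 := mul_left_cancel₀ hm0 (by linarith)
    omega
  · intro h
    have h1 : m ^ 2 ∣ E * 2 := by
      rw [← h𝔮.pow_eq_one_iff_dvd, pow_mul, h]; norm_num
    have h3 : ¬ m ^ 2 ∣ E := by
      rw [← h𝔮.pow_eq_one_iff_dvd, h]
      intro h4
      exact h2 (by linear_combination -h4)
    obtain ⟨w, hw⟩ := h1
    rcases Nat.even_or_odd' w with ⟨z, rfl | rfl⟩
    · exact absurd ⟨z, by linarith⟩ h3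
    · refine ⟨z, ?_⟩
      have : ((E * 2 : ℕ) : ℤ) = (m ^ 2 * (2 * z + 1) : ℕ) := by rw [hw]
      push_cast at this
      linarith

end Arithmetic

/-! ### Solving for the coaction element `v` -/

section CyclicPair

variable {k G : Type*} [Field k] [CommGroup G]
variable {m : ℕ} {g : G} {hg : ∀ x, x ∈ Subgroup.zpowers g} {hG : Nat.card G = m}
  {hm : 2 ≤ m} {c f lam : ℕ}

theorem chi_congr {q : k} {hq : IsPrimitiveRoot q m} {a b : ℕ} (h : q ^ a = q ^ b) :
    chi hg hG hq hm a = chi hg hG hq hm b := by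
  refine MonoidAlgebra.algHom_ext (fun x => ?_) (Subsingleton.elim _ _)
  obtain ⟨s, -, rfl⟩ := exists_pow hg hG hm x
  have h' := fun a => chi_of hg hG hq hm a s
  simp only [MonoidAlgebra.of_apply] at h'
  simp only [h', pow_mul, h]

theorem chi_add_mul {q : k} {hq : IsPrimitiveRoot q m} (a t : ℕ) :
    chi hg hG hq hm (a + m * t) = chi hg hG hq hm a :=
  chi_congr (by rw [pow_add, pow_mul, hq.pow_eq_one, one_pow, mul_one])

variable {𝔮 : k} (h𝔮 : IsPrimitiveRoot 𝔮 (m ^ 2))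

/-- The sum defining `v` runs over `1, …, m`, so the value at `a = 0` is read off at `j = m`, where
the exponent is `m²λ + cfm`. It is divisible by `m²` because `m ∣ cf`. -/
theorem chi_cyclicV (hdvd : m ∣ c * f) {a : ℕ} (ha : a < m) :
    chi hg hG (isPrimitiveRoot_pow hm h𝔮) hm a (cyclicV m 𝔮 g c f lam) =
      𝔮 ^ ((m * lam + c * f) * a) := by
  simp only [cyclicV, map_sum, map_smul, chi_idem, smul_eq_mul]
  rcases Nat.eq_zero_or_pos a with rfl | h0
  · rw [Finset.sum_eq_single m]
    · obtain ⟨d, hd⟩ := hdvd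
      rw [if_pos (by simp), mul_one, hd, show m * lam * m + m * d * m = m ^ 2 * (lam + d) by ring,
        pow_mul, h𝔮.pow_eq_one]
      simp
    · intro b hb hne
      rw [Finset.mem_Icc] at hb
      rw [Nat.zero_mod, Nat.mod_eq_of_lt (by omega), if_neg (by omega), mul_zero]
    · intro h
      exact absurd (Finset.mem_Icc.mpr ⟨by omega, le_rfl⟩) h
  · rw [Finset.sum_eq_single a]
    · rw [if_pos rfl, mul_one, add_mul]
    · intro b hb hne
      rw [Finset.mem_Icc] at hb
      rw [Nat.mod_eq_of_lt ha, if_neg, mul_zero]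
      rcases hb.2.lt_or_eq with h | rfl
      · rw [Nat.mod_eq_of_lt h]; exact hne.symm
      · rw [Nat.mod_self]; omega
    · intro h
      exact absurd (Finset.mem_Icc.mpr ⟨h0, ha.le⟩) h

theorem cyclicV_isTwistedCharacter (hf : f < m) (hdvd : m ∣ c * f) :
    IsTwistedCharacter hg hG (isPrimitiveRoot_pow hm h𝔮) hm c f (cyclicV m 𝔮 g c f lam) := by
  intro a ha b hb
  have hab := Nat.mod_add_div (a + b) m
  rw [cocycle, Nat.mod_eq_of_lt ha, Nat.mod_eq_of_lt hb, Nat.mod_eq_of_lt hf]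
  generalize (a + b) / m = t at *
  rw [← hab, chi_add_mul, chi_cyclicV h𝔮 hdvd ha, chi_cyclicV h𝔮 hdvd hb,
    chi_cyclicV h𝔮 hdvd (Nat.mod_lt _ (by omega)), ← pow_add, ← pow_mul, ← pow_add]
  -- A carry `t` in `a + b` costs `m(cft)`, which is the cocycle factor `q^(cft)`, and `m²λt`, which
  -- is invisible to `𝔮`.
  have e : (m * lam + c * f) * a + (m * lam + c * f) * b =
      (m * lam + c * f) * ((a + b) % m) + m * (c * f * t) + m ^ 2 * (lam * t) := by
    rw [← mul_add, ← hab]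
    simp only [Nat.add_mul_mod_self_left, Nat.mod_mod]
    ring
  rw [e, pow_add _ _ (m ^ 2 * _), pow_mul 𝔮 (m ^ 2), h𝔮.pow_eq_one, one_pow, mul_one]

theorem IsTwistedCharacter.exists_eq_cyclicV (h2 : (2 : k) ≠ 0) (hf : f < m)
    {v : MonoidAlgebra k G}
    (hv : IsTwistedCharacter hg hG (isPrimitiveRoot_pow hm h𝔮) hm c f v)
    (hv0 : chi hg hG (isPrimitiveRoot_pow hm h𝔮) hm 0 v = 1)
    (hvf : chi hg hG (isPrimitiveRoot_pow hm h𝔮) hm f v = -1) :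
    ∃ lam < m, CyclicCond m c f lam ∧ v = cyclicV m 𝔮 g c f lam := by
  have hq := isPrimitiveRoot_pow hm h𝔮
  have h0 : 𝔮 ≠ 0 := h𝔮.ne_zero (by positivity)
  set w := chi hg hG (isPrimitiveRoot_pow hm h𝔮) hm 1 v with hw
  -- No carry occurs below `m`, so the twisted character is multiplicative there.
  have hpow : ∀ a < m, chi hg hG (isPrimitiveRoot_pow hm h𝔮) hm a v = w ^ a := by
    intro a
    induction a with
    | zero => intro _; rw [hv0, pow_zero]
    | succ a ih =>
      intro ha
      have h := hv a (by omega) 1 (by omega)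
      rw [cocycle, Nat.mod_eq_of_lt (by omega : a < m), Nat.mod_eq_of_lt (by omega : 1 < m),
        Nat.div_eq_of_lt ha, mul_zero, pow_zero, mul_one, ih (by omega), ← hw] at h
      rw [← h, pow_succ]
  -- The only carry needed is the one in `(m - 1) + 1`, which produces the factor `q^(cf) =
  -- (𝔮^(cf))^m`.
  have hwm : w ^ m = (𝔮 ^ (c * f)) ^ m := by
    have h := hv (m - 1) (by omega) 1 (by omega)
    have h1 : chi hg hG (isPrimitiveRoot_pow hm h𝔮) hm (m - 1 + 1) v = 1 := by
      rw [← hv0, ← chi_add_mul 0 1]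
      congr 2
      omega
    rw [h1, cocycle, Nat.mod_eq_of_lt (by omega : m - 1 < m), Nat.mod_eq_of_lt (by omega : 1 < m),
      Nat.mod_eq_of_lt hf, Nat.sub_add_cancel (by omega), Nat.div_self (by omega), mul_one,
      one_mul, hpow _ (by omega), ← hw, ← pow_succ, Nat.sub_add_cancel (by omega)] at h
    rw [h, ← pow_mul, ← pow_mul, mul_comm]
  have : NeZero m := ⟨by omega⟩
  -- The `m`-th roots of `q^(cf)` differ from `𝔮^(cf)` by powers of `q`; `λ` is the exponent.
  obtain ⟨lam, hlam, hl⟩ := hq.eq_pow_of_pow_eq_one (ξ := w / 𝔮 ^ (c * f))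
    (by rw [div_pow, hwm, div_self (by positivity)])
  have hw' : w = 𝔮 ^ (m * lam + c * f) := by
    rw [pow_add, pow_mul, hl, div_mul_cancel₀ _ (by positivity)]
  have hcond : CyclicCond m c f lam := by
    rw [cyclicCond_iff_pow h2 hm h𝔮, ← hvf, hpow f hf, hw', ← pow_mul]
  refine ⟨lam, hlam, hcond, ?_⟩
  refine sep_H hg hG (isPrimitiveRoot_pow hm h𝔮) hm fun a ha => ?_
  rw [chi_cyclicV h𝔮 (even_and_dvd_of_cyclicCond hm hcond).2 ha, hpow a ha, hw', ← pow_mul]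

theorem cyclic_isAdmissiblePair_and_isNontrivialTwoDim (h2 : (2 : k) ≠ 0) (hf : f < m)
    (h : CyclicCond m c f lam) :
    IsAdmissiblePair (kPhi hg hG hm h𝔮 c) (cyclicSigma hg hG hm h𝔮 f)
        (cyclicV m 𝔮 g c f lam) ∧
      IsNontrivialTwoDim (kPhi hg hG hm h𝔮 c)
        (Bsv (kPhi hg hG hm h𝔮 c) (cyclicSigma hg hG hm h𝔮 f) (cyclicV m 𝔮 g c f lam)) := by
  have hdvd := (even_and_dvd_of_cyclicCond hm h).2
  have hv : IsTwistedCharacter hg hG (isPrimitiveRoot_pow hm h𝔮) hm c f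
    (cyclicV m 𝔮 g c f lam) := cyclicV_isTwistedCharacter h𝔮 hf hdvd
  have hv0 : chi hg hG (isPrimitiveRoot_pow hm h𝔮) hm 0 (cyclicV m 𝔮 g c f lam) = 1 := by
    rw [chi_cyclicV h𝔮 hdvd (by omega), mul_zero, pow_zero]
  have hvf : chi hg hG (isPrimitiveRoot_pow hm h𝔮) hm f (cyclicV m 𝔮 g c f lam) = -1 := by
    rw [chi_cyclicV h𝔮 hdvd hf, (cyclicCond_iff_pow h2 hm h𝔮).mp h]
  exact ⟨isAdmissiblePair_chi hv hv0 hvf, Bsv_isNontrivialTwoDim h2 hv hv0 hvf⟩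

end CyclicPair

/-! ### Augmented bases of two-dimensional braided Hopf algebras -/

section TwoDim

variable {k H B : Type*} [Field k] [Ring H] [Algebra k H] [AddCommGroup B] [Module k B]

/-- Isomorphisms of braided Hopf algebras can be tested on a spanning pair. -/
theorem BraidedHopfData.isomorphic_of_span_pair {B' : Type*} [AddCommGroup B'] [Module k B']
    {D : BraidedHopfData k H B} {D' : BraidedHopfData k H B'} (φ : B ≃ₗ[k] B') {x y : B}
    (hspan : ∀ b, ∃ s t : k, b = s • x + t • y)
    (act_x : ∀ h, φ (D.act h x) = D'.act h (φ x)) (act_y : ∀ h, φ (D.act h y) = D'.act h (φ y))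
    (coact_x : D'.coact (φ x) = φ.toLinearMap.lTensor H (D.coact x))
    (coact_y : D'.coact (φ y) = φ.toLinearMap.lTensor H (D.coact y))
    (mul_xx : φ (D.mul (x ⊗ₜ x)) = D'.mul (φ x ⊗ₜ φ x))
    (mul_xy : φ (D.mul (x ⊗ₜ y)) = D'.mul (φ x ⊗ₜ φ y))
    (mul_yx : φ (D.mul (y ⊗ₜ x)) = D'.mul (φ y ⊗ₜ φ x))
    (mul_yy : φ (D.mul (y ⊗ₜ y)) = D'.mul (φ y ⊗ₜ φ y))
    (one : φ D.one = D'.one)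
    (comul_x : D'.comul (φ x) = TensorProduct.map φ.toLinearMap φ.toLinearMap (D.comul x))
    (comul_y : D'.comul (φ y) = TensorProduct.map φ.toLinearMap φ.toLinearMap (D.comul y))
    (counit_x : D'.counit (φ x) = D.counit x) (counit_y : D'.counit (φ y) = D.counit y) :
    D.Isomorphic D' := by
  refine ⟨φ, fun h b => ?_, fun b => ?_, fun b b' => ?_, one, fun b => ?_, fun b => ?_⟩ <;>
    obtain ⟨s, t, rfl⟩ := hspan b
  · simp only [map_add, map_smul, act_x, act_y]
  · simp only [map_add, map_smul, coact_x, coact_y]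
  · obtain ⟨s', t', rfl⟩ := hspan b'
    simp only [TensorProduct.tmul_add, TensorProduct.add_tmul, TensorProduct.tmul_smul,
      ← TensorProduct.smul_tmul', map_add, map_smul, mul_xx, mul_xy, mul_yx, mul_yy]
  · simp only [map_add, map_smul, comul_x, comul_y]
  · simp only [map_add, map_smul, counit_x, counit_y]

/-- A basis `{1, n}` of a two-dimensional braided Hopf algebra with `ε(n) = 0`. The functional
`coord` is the coordinate of `n`. -/
structure AugmentedBasis (D : BraidedHopfData k H B) (n : B) (coord : B →ₗ[k] k) : Prop where
  counit_one : D.counit D.one = 1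
  counit_n : D.counit n = 0
  coord_one : coord D.one = 0
  coord_n : coord n = 1
  decomp : ∀ b, b = D.counit b • D.one + coord b • n

theorem exists_augmentedBasis {D : BraidedHopfData k H B} (h1 : D.counit D.one = 1)
    (h2 : Module.finrank k B = 2) : ∃ n coord, AugmentedBasis D n coord := by
  have : FiniteDimensional k B := Module.finite_of_finrank_pos (by omega)
  have hr : LinearMap.range D.counit = ⊤ := by
    rw [LinearMap.range_eq_top]
    intro x
    exact ⟨x • D.one, by rw [map_smul, h1, smul_eq_mul, mul_one]⟩
  have hk : Module.finrank k (LinearMap.ker D.counit) = 1 := by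
    have h := LinearMap.finrank_range_add_finrank_ker D.counit
    rw [hr, finrank_top, Module.finrank_self, h2] at h
    omega
  obtain ⟨n, hn0, hn⟩ := finrank_eq_one_iff'.mp hk
  have hn0' : (n : B) ≠ 0 := fun h => hn0 (Subtype.ext h)
  have hcn : D.counit n = 0 := n.2
  obtain ⟨ψ, hψ⟩ := Module.Projective.exists_dual_ne_zero k hn0'
  -- Subtracting `ψ(1) ε` makes `ψ` vanish at `1` without changing its value at `n`.
  let coord : B →ₗ[k] k := (ψ n)⁻¹ • (ψ - ψ D.one • D.counit)
  have c1 : coord D.one = 0 := by simp [coord, h1]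
  have cn : coord n = 1 := by simp [coord, hcn, hψ]
  refine ⟨n, coord, h1, hcn, c1, cn, fun b => ?_⟩
  obtain ⟨t, ht⟩ := hn ⟨b - D.counit b • D.one, by simp [h1]⟩
  have ht' : t • (n : B) = b - D.counit b • D.one := congrArg Subtype.val ht
  have hb : b = D.counit b • D.one + t • (n : B) := by rw [ht']; abel
  have : coord b = t := by
    rw [hb, map_add, map_smul, map_smul, c1, cn, smul_zero, zero_add, smul_eq_mul, mul_one]
  rw [this, ← hb]

namespace AugmentedBasis

variable {D : BraidedHopfData k H B} {n : B} {coord : B →ₗ[k] k}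

theorem ne_zero (hn : AugmentedBasis D n coord) : n ≠ 0 := by
  rintro rfl
  simpa using hn.coord_n

theorem tmul_decomp (hn : AugmentedBasis D n coord)
    {M : Type*} [AddCommGroup M] [Module k M] (z : M ⊗[k] B) :
    z = TensorProduct.rid k M (D.counit.lTensor M z) ⊗ₜ D.one +
      TensorProduct.rid k M (coord.lTensor M z) ⊗ₜ n := by
  induction z with
  | zero => simp
  | tmul x b =>
    conv_lhs => rw [hn.decomp b]
    simp [TensorProduct.tmul_add, TensorProduct.smul_tmul]
  | add x y hx hy =>
    simp only [map_add, TensorProduct.add_tmul]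
    conv_lhs => rw [hx, hy]
    abel

theorem eq_smul (hn : AugmentedBasis D n coord) {b : B} (hb : D.counit b = 0) : b = coord b • n := by
  have := hn.decomp b
  rwa [hb, zero_smul, zero_add] at this

end AugmentedBasis

end TwoDim

/-! ### Structure constants, and the case `f ≠ 0` -/

section Classification

variable {k G B : Type*} [Field k] [CommGroup G] [AddCommGroup B] [Module k B]
variable {m : ℕ} {q : k} {g : G} {hg : ∀ x, x ∈ Subgroup.zpowers g} {hG : Nat.card G = m}
  {hq : IsPrimitiveRoot q m} {hm : 2 ≤ m} {c : ℕ}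
  {D : BraidedHopfData k (MonoidAlgebra k G) B} {n : B} {coord : B →ₗ[k] k}

/-- The eigenvalue of `g` is an `m`-th root of unity because `g^m = 1`, hence a power of `q`. -/
theorem exists_chi_of_act_smul (r : MonoidAlgebra k G →ₐ[k] Module.End k B) (hn0 : n ≠ 0)
    (hr : ∀ h, ∃ t : k, r h n = t • n) :
    ∃ f < m, ∀ h, r h n = chi hg hG hq hm f h • n := by
  obtain ⟨t, ht⟩ := hr (MonoidAlgebra.of k G g)
  have hpow : ∀ s : ℕ, r (MonoidAlgebra.of k G (g ^ s)) n = t ^ s • n := by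
    intro s
    induction s with
    | zero => simp only [pow_zero, map_one, Module.End.one_apply, one_smul]
    | succ s ih =>
      rw [pow_succ, map_mul, map_mul, Module.End.mul_apply, ht, map_smul, ih, smul_smul,
        pow_succ']
  have ho : g ^ m = 1 := by
    rw [← hG, ← orderOf_eq_card_of_forall_mem_zpowers hg, pow_orderOf_eq_one]
  have htm : t ^ m = 1 := by
    have h := hpow m
    rw [ho, map_one, map_one, Module.End.one_apply] at h
    refine smul_left_injective k hn0 ?_
    simp only [one_smul, ← h]
  have : NeZero m := ⟨by omega⟩
  obtain ⟨f, hf, hft⟩ := hq.eq_pow_of_pow_eq_one htm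
  refine ⟨f, hf, fun h => ?_⟩
  induction h using MonoidAlgebra.induction_on with
  | of x =>
    obtain ⟨s, -, rfl⟩ := exists_pow hg hG hm x
    rw [hpow, chi_of, ← hft, pow_mul]
  | add x y hx hy => simp only [map_add, LinearMap.add_apply, hx, hy, add_smul]
  | smul s x hx => simp only [map_smul, LinearMap.smul_apply, hx, smul_assoc]

/-- The structure constants of a two-dimensional braided Hopf algebra over `k_{Φ_c}[G]`. -/
structure StructureConstants (D : BraidedHopfData k (MonoidAlgebra k G) B)
    (hg : ∀ x, x ∈ Subgroup.zpowers g) (hG : Nat.card G = m)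
    (hq : IsPrimitiveRoot q m) (hm : 2 ≤ m) (c : ℕ) (n : B) (coord : B →ₗ[k] k) (f : ℕ)
    (v : MonoidAlgebra k G) (a b : k) : Prop where
  basis : AugmentedBasis D n coord
  one_homogeneous : IsHomogeneous hg hG hq hm D 0 1 D.one
  homogeneous : IsHomogeneous hg hG hq hm D f v n
  twisted : IsTwistedCharacter hg hG hq hm c f v
  chi_zero_v : chi hg hG hq hm 0 v = 1
  mul_nn : D.mul (n ⊗ₜ n) = a • n
  comul_n : D.comul n = n ⊗ₜ D.one + D.one ⊗ₜ n + b • (n ⊗ₜ n)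

theorem exists_structureConstants (hD : IsBraidedHopfAlgebra (cyclicQuasiBialgebra hg hG hq hm c) D)
    (h2 : Module.finrank k B = 2) :
    ∃ n coord, ∃ f < m, ∃ v a b, StructureConstants D hg hG hq hm c n coord f v a b := by
  obtain ⟨n, coord, hn⟩ := exists_augmentedBasis hD.counit_one h2
  have H1 : IsHomogeneous hg hG hq hm D 0 1 D.one :=
    ⟨fun h => by rw [hD.act_one, counit_eq_chi], hD.coact_one⟩
  obtain ⟨f, hf, hact⟩ := exists_chi_of_act_smul (hg := hg) (hG := hG) (hq := hq) (hm := hm)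
    D.act hn.ne_zero fun h => ⟨_, hn.eq_smul (by rw [hD.counit_act, hn.counit_n, mul_zero])⟩
  -- Colinearity of the counit removes the component of the coaction along `1`.
  have hco := hn.tmul_decomp (D.coact n)
  rw [hD.coact_counit, hn.counit_n, zero_smul, TensorProduct.zero_tmul, zero_add] at hco
  generalize TensorProduct.rid k _ (coord.lTensor _ (D.coact n)) = v at hco
  have hcm := hn.tmul_decomp (D.comul n)
  rw [hD.comul_counit] at hcm
  generalize TensorProduct.rid k _ (coord.lTensor _ (D.comul n)) = y at hcm
  -- So far `Δ(n) = n ⊗ 1 + y ⊗ n`. The other counit law gives `ε(y) = 1`, so `y = 1 + b n`.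
  have hy : D.counit y = 1 := by
    have h := hD.counit_comul n
    rw [hcm] at h
    have h' := congrArg coord h
    simpa [hn.counit_n, hn.coord_n, hn.coord_one] using h'
  have hyd := hn.decomp y
  rw [hy, one_smul] at hyd
  refine ⟨n, coord, f, hf, v, coord (D.mul (n ⊗ₜ n)), coord y, hn, H1, ⟨hact, hco⟩, ?_, ?_, ?_, ?_⟩
  · exact (twistedCharacter_iff hg hG hq hm c f v).mp
      ((QuasiBialgebra.coassoc_eigen_iff _ hact hco hn.ne_zero).mp
        (hD.isYDModule.coact_coassoc n))
  · have h := congrArg coord (hD.isYDModule.counit_coact n)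
    rw [hco] at h
    simpa [counit_eq_chi, hn.coord_n] using h
  · exact hn.eq_smul (by rw [hD.counit_mul, hn.counit_n, mul_zero])
  · rw [hcm]
    conv_lhs => rw [hyd]
    rw [TensorProduct.add_tmul, TensorProduct.smul_tmul', add_assoc]

namespace StructureConstants

variable {f : ℕ} {v : MonoidAlgebra k G} {a b : k}

theorem eq_zero_of_ne_zero (hS : StructureConstants D hg hG hq hm c n coord f v a b)
    (hD : IsBraidedHopfAlgebra (cyclicQuasiBialgebra hg hG hq hm c) D) (hf : f < m)
    (hf0 : f ≠ 0) : a = 0 ∧ b = 0 := by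
  have hn := hS.basis
  have H1 := hS.one_homogeneous
  have Hn := hS.homogeneous
  have hq1 : q ^ f ≠ 1 := hq.pow_ne_one_of_pos_of_lt hf0 hf
  have hq0 : q ^ f ≠ 0 := pow_ne_zero _ (hq.ne_zero (by omega))
  have e1 : ∀ f, chi hg hG hq hm f (MonoidAlgebra.of k G g) = q ^ f := fun f => by
    simpa using chi_of hg hG hq hm f 1
  -- Comparing the weights of `n` and `n ⊗ n` under `g` gives this equation for both `a` and `b`;
  -- its solution is `0` since `q^f` is neither `0` nor `1`.
  have key : ∀ x : k, x * q ^ f = q ^ (f + f) * x → x = 0 := by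
    intro x hx
    have : q ^ f * (1 - q ^ f) * x = 0 := by rw [pow_add] at hx; linear_combination hx
    rcases mul_eq_zero.mp this with h | h
    · exact absurd h (mul_ne_zero hq0 (sub_ne_zero.mpr hq1.symm))
    · exact h
  constructor
  · have h := LinearMap.congr_fun (hD.act_mul (MonoidAlgebra.of k G g)) (n ⊗ₜ n)
    rw [LinearMap.comp_apply, LinearMap.comp_apply, hS.mul_nn, map_smul, Hn.act,
      Hn.diagAct c Hn, map_smul, hS.mul_nn, e1, e1] at h
    have h' := congrArg coord h
    simp only [map_smul, smul_eq_mul, hn.coord_n, mul_one] at h'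
    exact key a h'
  · have h := LinearMap.congr_fun (hD.comul_act (MonoidAlgebra.of k G g)) n
    rw [LinearMap.comp_apply, LinearMap.comp_apply, Hn.act, map_smul, hS.comul_n, map_add, map_add,
      map_smul, Hn.diagAct c Hn, Hn.diagAct c H1, H1.diagAct c Hn, e1, e1, e1, e1] at h
    have h' := congrArg (mul' k k ∘ₗ TensorProduct.map coord coord) h
    simp only [LinearMap.comp_apply, map_add, map_smul, TensorProduct.map_tmul,
      LinearMap.mul'_apply, hn.coord_n, hn.coord_one, smul_eq_mul] at h'
    exact key b (by linear_combination h')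

/-- In `Δ(n)Δ(n)` all associators are trivial. The products `(n ⊗ 1)(1 ⊗ n)` and `(1 ⊗ n)(n ⊗ 1)`
contribute `1` and `χ_f(v)` to the coefficient of `n ⊗ n`, whose sum must vanish as `n² = 0`. -/
theorem chi_v_eq_neg_one (hS : StructureConstants D hg hG hq hm c n coord f v 0 0)
    (hD : IsBraidedHopfAlgebra (cyclicQuasiBialgebra hg hG hq hm c) D) :
    chi hg hG hq hm f v = -1 := by
  have hn := hS.basis
  have H1 := hS.one_homogeneous
  have Hn := hS.homogeneous
  have h := LinearMap.congr_fun hD.comul_mul (n ⊗ₜ n)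
  rw [LinearMap.comp_apply, LinearMap.comp_apply, TensorProduct.map_tmul, hS.mul_nn, hS.comul_n,
    zero_smul, zero_smul, add_zero, map_zero, TensorProduct.tmul_add, TensorProduct.add_tmul,
    TensorProduct.add_tmul, map_add, map_add, map_add, Hn.tensorMul c H1 Hn H1,
    Hn.tensorMul c H1 H1 Hn, H1.tensorMul c Hn Hn H1, H1.tensorMul c Hn H1 Hn, hD.one_mul,
    hD.one_mul, hD.mul_one, hS.mul_nn] at h
  have h' := congrArg (mul' k k ∘ₗ TensorProduct.map coord coord) h
  simp [hn.coord_n, cocycle_zero_mid hm,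
    cocycle_zero_right hm] at h'
  linear_combination -h'

theorem mul_eq_neg_two (hS : StructureConstants D hg hG hq hm c n coord 0 v a b)
    (hD : IsBraidedHopfAlgebra (cyclicQuasiBialgebra hg hG hq hm c) D) : a * b = -2 := by
  have hn := hS.basis
  have H1 := hS.one_homogeneous
  have Hn := hS.homogeneous
  have key : ∀ {b₁ b₂ b₃ b₄ : B} {v₁ v₂ v₃ v₄ : MonoidAlgebra k G},
      IsHomogeneous hg hG hq hm D 0 v₁ b₁ → IsHomogeneous hg hG hq hm D 0 v₂ b₂ →
      IsHomogeneous hg hG hq hm D 0 v₃ b₃ → IsHomogeneous hg hG hq hm D 0 v₄ b₄ →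
      chi hg hG hq hm 0 v₂ = 1 →
      YD.tensorMul (cyclicQuasiBialgebra hg hG hq hm c) D ((b₁ ⊗ₜ b₂) ⊗ₜ (b₃ ⊗ₜ b₄)) =
        D.mul (b₁ ⊗ₜ b₃) ⊗ₜ D.mul (b₂ ⊗ₜ b₄) := by
    intro _ _ _ _ _ _ _ _ h₁ h₂ h₃ h₄ h
    rw [h₁.tensorMul c h₂ h₃ h₄]
    simp [h]
  have hv1 : chi hg hG hq hm 0 (1 : MonoidAlgebra k G) = 1 := map_one _
  -- For `f = 0` associators and braiding are trivial on these elements; the two sides are the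
  -- coefficients of `n ⊗ n` in `Δ(a n)` and in `Δ(n)²`.
  have hquad : a * b = 2 + 4 * (a * b) + (a * b) ^ 2 := by
    have h := LinearMap.congr_fun hD.comul_mul (n ⊗ₜ n)
    rw [LinearMap.comp_apply, LinearMap.comp_apply, TensorProduct.map_tmul, hS.mul_nn, map_smul,
      hS.comul_n] at h
    simp only [TensorProduct.tmul_add, TensorProduct.add_tmul, TensorProduct.tmul_smul,
      ← TensorProduct.smul_tmul', map_add, map_smul, key Hn H1 Hn H1 hv1, key Hn H1 H1 Hn hv1,
      key Hn H1 Hn Hn hv1, key H1 Hn Hn H1 hS.chi_zero_v, key H1 Hn H1 Hn hS.chi_zero_v,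
      key H1 Hn Hn Hn hS.chi_zero_v, key Hn Hn Hn H1 hS.chi_zero_v,
      key Hn Hn H1 Hn hS.chi_zero_v, key Hn Hn Hn Hn hS.chi_zero_v, hD.one_mul, hD.mul_one,
      hS.mul_nn] at h
    have h' := congrArg (mul' k k ∘ₗ TensorProduct.map coord coord) h
    simp [hn.coord_n, hn.coord_one] at h'
    linear_combination h'
  have hS1 : D.antipode D.one = D.one := by
    have h := hD.antipode_left D.one
    rwa [hD.comul_one, LinearMap.rTensor_tmul, hD.mul_one, hD.counit_one, one_smul] at h
  have hanti := hD.antipode_left n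
  simp only [hS.comul_n, map_add, map_smul, LinearMap.rTensor_tmul, hS1, hD.mul_one, hD.one_mul,
    hn.counit_n, zero_smul] at hanti
  have h0 : D.counit (D.antipode n) = 0 := by
    have h := congrArg D.counit hanti
    simpa [hD.counit_mul, hn.counit_n] using h
  rw [hn.eq_smul h0] at hanti
  have h := congrArg coord hanti
  simp only [← TensorProduct.smul_tmul', map_add, map_smul, hS.mul_nn, hn.coord_n, smul_eq_mul,
    map_zero] at h
  -- If `S(n) = s n`, the antipode axiom says `s (1 + ab) = -1`, which rules out the root `ab = -1`.
  have hfac : (a * b + 1) * (a * b + 2) = 0 := by linear_combination -hquad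
  rcases mul_eq_zero.mp hfac with h' | h'
  · have : (1 : k) = 0 := by linear_combination h - coord (D.antipode n) * h'
    exact absurd this one_ne_zero
  · linear_combination h'

/-- Colinearity of the product on `n ⊗ n` makes `v` idempotent, and for `f = 0` the twisted
character is a genuine one, so all `χ_i(v)` are invertible. -/
theorem v_eq_one (hS : StructureConstants D hg hG hq hm c n coord 0 v a b)
    (hD : IsBraidedHopfAlgebra (cyclicQuasiBialgebra hg hG hq hm c) D) (ha : a ≠ 0) : v = 1 := by
  have hn := hS.basis
  have Hn := hS.homogeneous
  have hidem : v = v * v := by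
    have h := LinearMap.congr_fun hD.coact_mul (n ⊗ₜ n)
    rw [LinearMap.comp_apply, LinearMap.comp_apply, hS.mul_nn, map_smul, Hn.coact,
      Hn.diagCoact c Hn (Or.inl rfl), LinearMap.lTensor_tmul, hS.mul_nn,
      TensorProduct.tmul_smul] at h
    have h' := congrArg (TensorProduct.rid k _ ∘ coord.lTensor (MonoidAlgebra k G))
      (smul_right_injective _ ha h)
    simpa [hn.coord_n] using h'
  refine sep_H hg hG hq hm fun i hi => ?_
  -- The residue `(m - i) % m` represents `-i`, including at `i = 0`.
  have h1 : chi hg hG hq hm i v * chi hg hG hq hm ((m - i) % m) v = 1 := by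
    rw [hS.twisted i hi _ (Nat.mod_lt _ (by omega)), cocycle_zero_left, mul_one, ← hS.chi_zero_v]
    refine DFunLike.congr_fun (chi_congr ?_) v
    rw [pow_zero, hq.pow_eq_one_iff_dvd]
    refine Nat.dvd_of_mod_eq_zero ?_
    rw [Nat.add_mod, Nat.mod_mod, ← Nat.add_mod, Nat.add_sub_cancel' hi.le, Nat.mod_self]
  have h2 : chi hg hG hq hm i v = chi hg hG hq hm i v * chi hg hG hq hm i v := by
    rw [← map_mul, ← hidem]
  rw [map_one]
  have h3 : chi hg hG hq hm i v ≠ 0 := left_ne_zero_of_mul_eq_one h1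
  exact mul_left_cancel₀ h3 (by rw [← h2, mul_one])

/-- The decomposition of `B` along its augmented basis, as an isomorphism onto `k[n]/(n²)`. -/
def dualNumberEquiv (hn : AugmentedBasis D n coord) : B ≃ₗ[k] DualNumber k where
  toFun b := D.counit b • 1 + coord b • DualNumber.eps
  map_add' x y := by simp only [map_add, add_smul]; abel
  map_smul' t x := by simp only [map_smul, smul_eq_mul, mul_smul, smul_add, RingHom.id_apply]
  invFun x := x.fst • D.one + x.snd • n
  left_inv b := by simpa using (hn.decomp b).symm
  right_inv x := by ext <;> simp [hn.counit_one, hn.counit_n, hn.coord_one, hn.coord_n]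

theorem dualNumberEquiv_apply (hn : AugmentedBasis D n coord) (b : B) :
    dualNumberEquiv hn b = D.counit b • 1 + coord b • DualNumber.eps := rfl

theorem isomorphic_Bsv (hS : StructureConstants D hg hG hq hm c n coord f v 0 0)
    (hD : IsBraidedHopfAlgebra (cyclicQuasiBialgebra hg hG hq hm c) D) :
    D.Isomorphic (Bsv (cyclicQuasiBialgebra hg hG hq hm c) (chi hg hG hq hm f) v) := by
  have hn := hS.basis
  have H1 := hS.one_homogeneous
  have Hn := hS.homogeneous
  have φ1 : dualNumberEquiv hn D.one = 1 := by
    simp [dualNumberEquiv_apply, hn.counit_one, hn.coord_one]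
  have φn : dualNumberEquiv hn n = DualNumber.eps := by
    simp [dualNumberEquiv_apply, hn.counit_n, hn.coord_n]
  refine BraidedHopfData.isomorphic_of_span_pair (dualNumberEquiv hn)
    (fun b => ⟨_, _, hn.decomp b⟩) ?_ ?_ ?_ ?_ ?_ ?_ ?_ ?_ ?_ ?_ ?_ ?_ ?_ <;>
  simp [φ1, φn, H1.act, Hn.act, H1.coact, Hn.coact, hD.one_mul, hD.mul_one, hS.mul_nn,
    hD.comul_one, hS.comul_n, hn.counit_one, hn.counit_n, counit_eq_chi]

end StructureConstants

end Classification

/-! ### The group algebra of `C₂` -/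

section GroupAlgebraC2

variable {k : Type*} [Field k]

/-- The generator of `k[C₂]`. -/
def c2Gen (k : Type*) [Field k] : MonoidAlgebra k (Multiplicative (ZMod 2)) :=
  MonoidAlgebra.single (Multiplicative.ofAdd 1) 1

theorem multiplicative_zmod_two_cases (z : Multiplicative (ZMod 2)) :
    z = 1 ∨ z = Multiplicative.ofAdd 1 := by
  revert z; decide

theorem c2Gen_mul_self : c2Gen k * c2Gen k = 1 := by
  rw [c2Gen, MonoidAlgebra.single_mul_single, mul_one, MonoidAlgebra.one_def]
  congr 1

theorem c2_ext {x y : MonoidAlgebra k (Multiplicative (ZMod 2))} (h1 : x.coeff 1 = y.coeff 1)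
    (hg : x.coeff (Multiplicative.ofAdd 1) = y.coeff (Multiplicative.ofAdd 1)) : x = y := by
  ext z
  rcases multiplicative_zmod_two_cases z with rfl | rfl
  · exact h1
  · exact hg

@[simp] theorem c2Gen_coeff_one : (c2Gen k).coeff 1 = 0 := by
  simp [c2Gen]

@[simp] theorem c2Gen_coeff_gen : (c2Gen k).coeff (Multiplicative.ofAdd 1) = 1 := by
  simp [c2Gen]

@[simp] theorem c2_one_coeff_one :
    (1 : MonoidAlgebra k (Multiplicative (ZMod 2))).coeff 1 = 1 := by
  simp [MonoidAlgebra.one_def]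

@[simp] theorem c2_one_coeff_gen :
    (1 : MonoidAlgebra k (Multiplicative (ZMod 2))).coeff (Multiplicative.ofAdd 1) = 0 := by
  simp [MonoidAlgebra.one_def]

theorem comul_c2Gen : Coalgebra.comul (R := k) (c2Gen k) = c2Gen k ⊗ₜ c2Gen k := by
  simp [c2Gen]

theorem counit_c2Gen : Coalgebra.counit (R := k) (c2Gen k) = 1 := by
  simp [c2Gen]

/-- The linear isomorphism onto `k[C₂]` with `1 ↦ 1` and `n ↦ b⁻¹ (x - 1)`, where `x` is the
generator of `C₂`. -/
def c2Equiv {H B : Type*} [Ring H] [Algebra k H] [AddCommGroup B] [Module k B]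
    {D : BraidedHopfData k H B} {n : B} {coord : B →ₗ[k] k} (hn : AugmentedBasis D n coord)
    {b : k} (hb : b ≠ 0) : B ≃ₗ[k] MonoidAlgebra k (Multiplicative (ZMod 2)) where
  toFun x := D.counit x • 1 + coord x • b⁻¹ • (c2Gen k - 1)
  map_add' x y := by simp only [map_add, add_smul]; abel
  map_smul' t x := by simp only [map_smul, smul_eq_mul, mul_smul, smul_add, RingHom.id_apply]
  invFun y := (y.coeff 1 + y.coeff (Multiplicative.ofAdd 1)) • D.one +
    (b * y.coeff (Multiplicative.ofAdd 1)) • n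
  left_inv x := by
    conv_rhs => rw [hn.decomp x]
    simp [mul_left_comm b, hb]
  right_inv y := by
    refine c2_ext ?_ ?_ <;>
      simp [hn.counit_one, hn.counit_n, hn.coord_one, hn.coord_n, hb, mul_right_comm b]

theorem c2Equiv_apply {H B : Type*} [Ring H] [Algebra k H] [AddCommGroup B] [Module k B]
    {D : BraidedHopfData k H B} {n : B} {coord : B →ₗ[k] k} (hn : AugmentedBasis D n coord)
    {b : k} (hb : b ≠ 0) (x : B) :
    c2Equiv hn hb x = D.counit x • 1 + coord x • b⁻¹ • (c2Gen k - 1) := rfl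

end GroupAlgebraC2

/-! ### The case `f = 0`, and the classification -/

section Classification

variable {k G B : Type*} [Field k] [CommGroup G] [AddCommGroup B] [Module k B]
variable {m : ℕ} {q : k} {g : G} {hg : ∀ x, x ∈ Subgroup.zpowers g} {hG : Nat.card G = m}
  {hq : IsPrimitiveRoot q m} {hm : 2 ≤ m} {c : ℕ}
  {D : BraidedHopfData k (MonoidAlgebra k G) B} {n : B} {coord : B →ₗ[k] k}

/-- The element `1 + b n` is group-like, and its square is `1 + b(2 + ab) n = 1`. It corresponds to
the generator of `C₂`. -/
theorem StructureConstants.isomorphic_trivialC2 {v : MonoidAlgebra k G} {a b : k}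
    (h2 : (2 : k) ≠ 0) (hS : StructureConstants D hg hG hq hm c n coord 0 v a b)
    (hD : IsBraidedHopfAlgebra (cyclicQuasiBialgebra hg hG hq hm c) D) :
    D.Isomorphic (trivialC2 (cyclicQuasiBialgebra hg hG hq hm c)) := by
  have hn := hS.basis
  have H1 := hS.one_homogeneous
  have Hn := hS.homogeneous
  have hab := hS.mul_eq_neg_two hD
  have ha : a ≠ 0 := by
    rintro rfl
    exact h2 (by linear_combination hab)
  have hb : b ≠ 0 := by
    rintro rfl
    exact h2 (by linear_combination hab)
  have hv := hS.v_eq_one hD ha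
  have φ1 : c2Equiv hn hb D.one = 1 := by
    simp [c2Equiv_apply, hn.counit_one, hn.coord_one]
  have φn : c2Equiv hn hb n = b⁻¹ • (c2Gen k - 1) := by
    simp [c2Equiv_apply, hn.counit_n, hn.coord_n]
  have hcomul1 : Coalgebra.comul (R := k) (1 : MonoidAlgebra k (Multiplicative (ZMod 2))) =
      1 ⊗ₜ 1 := Bialgebra.comul_one
  have hcounit1 : Coalgebra.counit (R := k) (1 : MonoidAlgebra k (Multiplicative (ZMod 2))) = 1 :=
    Bialgebra.counit_one
  refine BraidedHopfData.isomorphic_of_span_pair (c2Equiv hn hb)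
    (fun b => ⟨_, _, hn.decomp b⟩) ?_ ?_ ?_ ?_ ?_ ?_ ?_ ?_ ?_ ?_ ?_ ?_ ?_
  · intro h
    simp [trivialC2, φ1, H1.act, counit_eq_chi, Algebra.ofId_apply]
  · intro h
    simp [trivialC2, φn, Hn.act, counit_eq_chi, Algebra.ofId_apply, smul_comm _ b⁻¹]
  · simp [trivialC2, φ1, H1.coact]
  · simp [trivialC2, φn, Hn.coact, hv]
  · simp [trivialC2, φ1, hD.one_mul]
  · simp [trivialC2, φ1, hD.one_mul]
  · simp [trivialC2, φ1, hD.mul_one]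
  -- The relation `n² = a n` matches `(x - 1)² = -2(x - 1)` for the generator `x`, since `ab = -2`.
  · have ha' : a = -2 * b⁻¹ := by field_simp; exact hab
    have hsq : (c2Gen k - 1) * (c2Gen k - 1) = (-2 : k) • (c2Gen k - 1) := by
      have : (c2Gen k - 1) * (c2Gen k - 1) = c2Gen k * c2Gen k - 2 * c2Gen k + 1 := by ring
      rw [this, c2Gen_mul_self]
      refine c2_ext ?_ ?_ <;> simp [two_mul] <;> ring
    rw [hS.mul_nn, map_smul, φn]
    change _ = (b⁻¹ • (c2Gen k - 1)) * (b⁻¹ • (c2Gen k - 1))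
    rw [smul_mul_smul_comm, hsq, smul_smul, smul_smul, ha']
    congr 1
    ring
  · exact φ1
  · change Coalgebra.comul (c2Equiv hn hb D.one) = _
    rw [φ1, hcomul1, hD.comul_one, TensorProduct.map_tmul, LinearEquiv.coe_coe, φ1]
  · change Coalgebra.comul (c2Equiv hn hb n) = _
    rw [φn, map_smul, map_sub, hcomul1, comul_c2Gen, hS.comul_n]
    simp only [map_add, map_smul, TensorProduct.map_tmul, LinearEquiv.coe_coe, φ1, φn,
      TensorProduct.tmul_smul, ← TensorProduct.smul_tmul', TensorProduct.tmul_sub,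
      TensorProduct.sub_tmul]
    rw [smul_inv_smul₀ hb]
    module
  · change Coalgebra.counit (c2Equiv hn hb D.one) = _
    rw [φ1, hcounit1, hD.counit_one]
  · change Coalgebra.counit (c2Equiv hn hb n) = _
    rw [φn, map_smul, map_sub, hcounit1, counit_c2Gen, sub_self, smul_zero, hn.counit_n]

theorem IsNontrivialTwoDim.exists_isomorphic_Bsv (h2 : (2 : k) ≠ 0)
    (hD : IsNontrivialTwoDim (cyclicQuasiBialgebra hg hG hq hm c) D) :
    ∃ f < m, ∃ v, IsTwistedCharacter hg hG hq hm c f v ∧ chi hg hG hq hm 0 v = 1 ∧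
      chi hg hG hq hm f v = -1 ∧
      D.Isomorphic (Bsv (cyclicQuasiBialgebra hg hG hq hm c) (chi hg hG hq hm f) v) := by
  obtain ⟨n, coord, f, hf, v, a, b, hS⟩ := exists_structureConstants hD.isHopf hD.finrank_eq
  have hf0 : f ≠ 0 := by
    rintro rfl
    exact hD.nontrivial (hS.isomorphic_trivialC2 h2 hD.isHopf)
  obtain ⟨rfl, rfl⟩ := hS.eq_zero_of_ne_zero hD.isHopf hf hf0
  exact ⟨f, hf, v, hS.twisted, hS.chi_zero_v, hS.chi_v_eq_neg_one hD.isHopf,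
    hS.isomorphic_Bsv hD.isHopf⟩

end Classification

end YD

end

/-! ### Assembly of the three statements -/

theorem mainTheorem11 {k : Type*} [Field k] (h2 : (2 : k) ≠ 0) {G : Type*} [CommGroup G]
    {m : ℕ} (hm : 2 ≤ m) {g : G} (hg : ∀ x, x ∈ Subgroup.zpowers g) (hG : Nat.card G = m)
    {𝔮 : k} (h𝔮 : IsPrimitiveRoot 𝔮 (m ^ 2)) (c : ℕ) (hc : c < m) :
    -- existence forces `gcd(c, m)` to be even, and every example is some `B_{σ,v}`
    (∀ (B : Type*) [AddCommGroup B] [Module k B]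
      (D : YD.BraidedHopfData k (MonoidAlgebra k G) B),
      YD.IsNontrivialTwoDim (YD.kPhi hg hG hm h𝔮 c) D →
        Even (Nat.gcd c m) ∧
        ∃ f < m, ∃ lam < m, YD.CyclicCond m c f lam ∧
          D.Isomorphic (YD.Bsv (YD.kPhi hg hG hm h𝔮 c) (YD.cyclicSigma hg hG hm h𝔮 f)
            (YD.cyclicV m 𝔮 g c f lam))) ∧
    -- every such `B_{σ,v}` is an example
    (∀ f < m, ∀ lam < m, YD.CyclicCond m c f lam →
      YD.IsAdmissiblePair (YD.kPhi hg hG hm h𝔮 c) (YD.cyclicSigma hg hG hm h𝔮 f)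
        (YD.cyclicV m 𝔮 g c f lam) ∧
      YD.IsNontrivialTwoDim (YD.kPhi hg hG hm h𝔮 c)
        (YD.Bsv (YD.kPhi hg hG hm h𝔮 c) (YD.cyclicSigma hg hG hm h𝔮 f)
          (YD.cyclicV m 𝔮 g c f lam))) ∧
    -- an example exists when `gcd(c, m)` is even
    (Even (Nat.gcd c m) →
      ∃ f < m, ∃ lam < m, YD.CyclicCond m c f lam ∧
        YD.IsNontrivialTwoDim (YD.kPhi hg hG hm h𝔮 c)
          (YD.Bsv (YD.kPhi hg hG hm h𝔮 c) (YD.cyclicSigma hg hG hm h𝔮 f)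
            (YD.cyclicV m 𝔮 g c f lam))) := by
  refine ⟨fun B _ _ D hD => ?_, fun f hf lam _ h =>
    YD.cyclic_isAdmissiblePair_and_isNontrivialTwoDim h𝔮 h2 hf h, fun he => ?_⟩
  · obtain ⟨f, hf, v, hv, hv0, hvf, hiso⟩ := YD.IsNontrivialTwoDim.exists_isomorphic_Bsv
      (hq := YD.isPrimitiveRoot_pow hm h𝔮) h2 hD
    obtain ⟨lam, hlam, hcond, rfl⟩ := hv.exists_eq_cyclicV h𝔮 h2 hf hv0 hvf
    exact ⟨(YD.even_and_dvd_of_cyclicCond hm hcond).1, f, hf, lam, hlam, hcond, hiso⟩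
  · obtain ⟨f, hf, lam, hlam, hcond⟩ := YD.exists_cyclicCond hm he
    exact ⟨f, hf, lam, hlam, hcond,
      (YD.cyclic_isAdmissiblePair_and_isNontrivialTwoDim h𝔮 h2 hf hcond).2⟩
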